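/- **Outer length billiard.** Let $K\subset\mathbb R^2$ be a compact convex set with non-empty interior and let $x\notin K$ not lie on the clockwise extension of a segment contained in $\partial K$ ($\partial K$ being oriented counterclockwise). Let $\ell_1,\ell_2$ be the two support lines of $K$ through $x$, labelled so that travelling to $x$ from $K$ along $\ell_1$ keeps $K$ on the left; $\ell_2$ meets $K$ in a single point $p$. The *auxiliary circle* of $x$ is the circle tangent to $\ell_1$, tangent to $\ell_2$ at $p$, and lying on the side of $\ell_2$ opposite to $K$; its center is denoted $\chi(x)$. Let $\ell_3\neq \ell_1,\ell_2$ be the third common support line of $K$ and of this circle; then $T(x):=\ell_2\cap\ell_3$. A point $x$ is *nonsingular* if $T^n(x)$ is outside $K$ and off the clockwise extensions of boundary segments for all $n\ge 0$. The *once-around orbit* of a nonsingular point $x$ is $\mathcal O(x)=\{x,T(x),\dots,T^{2N}(x)\}$, where, in polar coordinates in which $x$ has argument $0$ and arguments lie in $[-\pi,\pi)$, $N$ is the smallest positive integer such that $T^{2(N-1)}(x)$ has positive argument and $T^{2N}(x)$ has non-positive argument; if there is no such $N$, $\mathcal O(x)$ is the whole forward orbit. **Support function and dual.** Let $h_K(\theta)=\max_{z\in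 K}\langle z,(\cos\theta,\sin\theta)\rangle$ and let $K_s=\frac12(K-K)$ be the symmetrization of $K$. If $K$ contains the origin in its interior, its symplectic polar dual is the body with radial function $1/h_K(\theta+\pi/2)$. **Theorem 4.2.** Let $K$ be a convex polygon of diameter $1$ whose interior contains the origin. For $d>0$ let $Q=dK$, let $T$ and $\chi$ be the outer length billiard map and the circle-center map about $Q$, and let $$\Gamma(\theta)=\frac1{h_{Q_s}(\theta+\pi/2)}=\frac{2}{h_Q(\theta+\pi/2)+h_Q(\theta-\pi/2)}$$ be the radial function of the symplectic polar dual of the symmetrization $Q_s$. There are constants $0<C_1\le C_2$ depending only on $K$ such that, whenever $0<d<1/C_2$ and $x_0$ is a nonsingular point for $Q$ on the unit circle, every $x\in\mathcal O(x_0)$ satisfies $\bigl|\,\|x\|-1\,\bigr|\le dC_1$. Further, there are positive constants $\epsilon$ and $C_3$, depending only on $K$, such that, if $0<d<1/C_2$ and $d\le\epsilon$, then for every such $x_0$ and every point $x=(r\cos\theta,r\sin\theta)$, $r>0$, in $\mathcal O(x_0)$, $$\bigl\|\chi(x)-\Gamma(\theta)\,(-\sin\theta,\cos\theta)\bigr\|\le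 C_3 .$$ -/

import Mathlib

open scoped Pointwise

namespace OuterLength

noncomputable section

/-! The Euclidean plane is `ℂ`: the norm is the Euclidean one and `z = r e^{iθ}` are polar
coordinates. -/

/-- The signed area of the parallelogram spanned by `u` and `v`; it is positive exactly when `v`
points to the left of the direction `u`. -/
def cross (u v : ℂ) : ℝ := u.re * v.im - u.im * v.re

/-- The line through `a` with direction `u`. -/
def line (a u : ℂ) : Set ℂ := {z | ∃ t : ℝ, z = a + (t : ℂ) * u}

/-- A (nondegenerate) convex polygon: the convex hull of finitely many points, with interior. -/
def IsConvexPolygon (K : Set ℂ) : Prop :=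
  ∃ V : Finset ℂ, K = convexHull ℝ (V : Set ℂ) ∧ (interior K).Nonempty

/-- The line through `a` in direction `u` is a support line of `K`, and `K` lies on the left of it
when one travels in the direction `u`. -/
def IsLeftSupport (K : Set ℂ) (a u : ℂ) : Prop :=
  u ≠ 0 ∧ (∀ z ∈ K, 0 ≤ cross u (z - a)) ∧ ∃ z ∈ K, z ∈ line a u

/-- `ℓ` is a support line of `K` (for one of its two orientations `K` is on the left). -/
def IsSupportLine (K ℓ : Set ℂ) : Prop := ∃ a u : ℂ, ℓ = line a u ∧ IsLeftSupport K a u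

/-- The line `ℓ` is tangent at `q` to the circle with centre `c` and radius `ρ`. -/
def IsTangentAt (c : ℂ) (ρ : ℝ) (ℓ : Set ℂ) (q : ℂ) : Prop :=
  q ∈ ℓ ∧ dist q c = ρ ∧ ∀ z ∈ ℓ, ρ ≤ dist z c

/-- The point `x` lies on the clockwise extension of a segment contained in the boundary of `K`:
the boundary segment is traversed counterclockwise from `a` to `b` (with `K` on the left), and `x`
lies, outside `K`, on the line of the segment behind `a`. -/
def OnClockwiseExtension (K : Set ℂ) (x : ℂ) : Prop :=
  x ∉ K ∧ ∃ a b : ℂ, a ≠ b ∧ segment ℝ a b ⊆ frontier K ∧ (∀ z ∈ K, 0 ≤ cross (b - a) (z - a)) ∧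
    ∃ t : ℝ, 0 < t ∧ x = a - (t : ℂ) * (b - a)

/-- The auxiliary circle of the point `x`, with centre `c` and radius `ρ`.
* `ℓ₁ = line x u₁` is the support line of `K` through `x` such that travelling to `x` from `K`
  along it keeps `K` on the left (`u₁` is the direction of travel);
* `ℓ₂ = line x u₂` is the other support line through `x`; travelling from `x` to `K` along it keeps
  `K` on the left, and it meets `K` in the single point `p`;
* the circle is tangent to `ℓ₁`, is tangent to `ℓ₂` at `p`, and is separated from `K` by `ℓ₂`. -/
structure IsAuxCircle (K : Set ℂ) (x u₁ u₂ p c : ℂ) (ρ : ℝ) : Prop where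
  support₁ : IsLeftSupport K x u₁
  contact₁ : ∃ t : ℝ, 0 < t ∧ x - (t : ℂ) * u₁ ∈ K
  support₂ : IsLeftSupport K x u₂
  contact₂ : ∃ t : ℝ, 0 < t ∧ p = x + (t : ℂ) * u₂
  single₂ : line x u₂ ∩ K = {p}
  radius_pos : 0 < ρ
  tangent₁ : ∃ q, IsTangentAt c ρ (line x u₁) q
  tangent₂ : IsTangentAt c ρ (line x u₂) p
  opposite : cross u₂ (c - x) < 0

/-- `y` is the image of `x`: the intersection of `ℓ₂` with a third common support line `ℓ₃`
of `K` and of the auxiliary circle, different from `ℓ₁` and `ℓ₂`. -/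
def IsImage (K : Set ℂ) (x y : ℂ) : Prop :=
  ∃ (u₁ u₂ p c : ℂ) (ρ : ℝ), IsAuxCircle K x u₁ u₂ p c ρ ∧
    ∃ ℓ₃ : Set ℂ, IsSupportLine K ℓ₃ ∧ (∃ q, IsTangentAt c ρ ℓ₃ q) ∧
      ℓ₃ ≠ line x u₁ ∧ ℓ₃ ≠ line x u₂ ∧ y ∈ line x u₂ ∩ ℓ₃

/-- The outer length billiard map about `K`. Its values matter only at points outside `K` which are
not on the clockwise extension of a boundary segment. -/
def T (K : Set ℂ) (x : ℂ) : ℂ := Classical.epsilon fun y => IsImage K x y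

/-- The centre of the auxiliary circle used in the construction of `T K x`. -/
def chi (K : Set ℂ) (x : ℂ) : ℂ :=
  Classical.epsilon fun c => ∃ (u₁ u₂ p : ℂ) (ρ : ℝ), IsAuxCircle K x u₁ u₂ p c ρ

/-- The set `Ω` of nonsingular points: every point of the forward orbit lies outside `K` and off
the clockwise extensions of the boundary segments. -/
def nonsingular (K : Set ℂ) : Set ℂ :=
  {x | ∀ n : ℕ, (T K)^[n] x ∉ K ∧ ¬ OnClockwiseExtension K ((T K)^[n] x)}

/-- The argument of `z`, with values in `[-π, π)`, in the polar coordinates in which `x` is on the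
ray `θ = 0`. (As `Complex.arg` takes values in `(-π, π]`, this is `-arg (x / z)`.) -/
def relArg (x z : ℂ) : ℝ := -Complex.arg (x / z)

/-- The squared map wraps around at its `N`-th iteration. -/
def WrapsAt (K : Set ℂ) (x : ℂ) (N : ℕ) : Prop :=
  0 < N ∧ 0 < relArg x ((T K)^[2 * (N - 1)] x) ∧ relArg x ((T K)^[2 * N] x) ≤ 0

/-- The once-around orbit `{x, T x, …, T^{2N} x}` of `x`, where `N` is the smallest positive
integer at which the squared map wraps around; the whole forward orbit if there is no such `N`. -/
def onceAround (K : Set ℂ) (x : ℂ) : Set ℂ :=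
  {z | ∃ n : ℕ, z = (T K)^[n] x ∧ ∀ N : ℕ, IsLeast {M | WrapsAt K x M} N → n ≤ 2 * N}

/-- The support function `h_K(θ)`: the signed distance from the origin to the support line of `K`
with outward normal `(cos θ, sin θ)`. -/
def supportFn (K : Set ℂ) (θ : ℝ) : ℝ :=
  sSup ((fun z : ℂ => z.re * Real.cos θ + z.im * Real.sin θ) '' K)

/-- The symmetrization `K_s = (K - K) / 2`. -/
def symmetrization (K : Set ℂ) : Set ℂ := (1 / 2 : ℝ) • (K - K)

/-- The symplectic polar dual of `K` is the body whose boundary has this radial function. -/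
def dualRadial (K : Set ℂ) (θ : ℝ) : ℝ := 1 / supportFn K (θ + Real.pi / 2)

end

end OuterLength

/-! From x the body Q is seen between a right support ray of direction e, touching Q at p at
distance t, and a left one turned by α, touching Q at q at distance s (`View`). The auxiliary circle
has radius ρ = t cot(α/2) and centre p - ρie. The image is y = p + σe; its view has left contact p,
right contact p' and angle β, and ρ = σ cot(β/2) as well, so one circle serves both views.

The almost invariant quantity is the energy S = st(1 + cos α). By the law of cosines 2S = (s + t)² -
‖q - p‖², so S = 2‖x‖² + O(d) for bounded x (`View.norm_bound`). On the other hand S = ρH, where H =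
s sin α is the height of q over the line ℓ₂, and the next energy is S' = ρH', where H' is the height
of p' over the same line. Thus S' - S = S(H' - H)/H, with H of order d. Both q and p' lie on support
lines inclined by O(d) to e, so |H' - H| ≤ O(d)X, where X ≥ 0 is the displacement from q to p' along
e. Hence |S' - S| ≤ CX.

A once-around orbit can have about 1/d steps, and bounding each X by d would lose everything. But X
is, up to d(α + β), the decrease of a potential of size at most 2d (`View.dot_le_potential_sub`).
Summing (`View.step`, `IsOrbit.energy_bound`) bounds the drift of the energy by Cd(1 + total turn).
The direction after n steps is (-1)ⁿe₀ exp(-i·turn), and a total turn above 3π would force an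
earlier wrap (`IsOrbit.turn_le`). So S = 2 + O(d) along the orbit, which gives the annulus.

For the centres (`View.norm_chi_sub_le`): ρ = S/H, H is the width of Q across the direction θ up to
O(d²), and e is opposite to the direction of x up to O(d). Multiplied by ρ = O(1/d), these errors
stay bounded. -/

namespace OuterLength

/-! ### Plane geometry: cross and dot products, lines, tangency to a circle. -/

/-- The Euclidean inner product of the plane. -/
def dot (u v : ℂ) : ℝ := u.re * v.re + u.im * v.im

theorem cross_mul_mul (e a b : ℂ) : cross (e * a) (e * b) = ‖e‖ ^ 2 * cross a b := by
  rw [Complex.sq_norm, Complex.normSq_apply]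
  simp only [cross, Complex.mul_re, Complex.mul_im]; ring

theorem cross_ofReal_mul_left (t : ℝ) (a b : ℂ) : cross ((t : ℂ) * a) b = t * cross a b := by
  simp [cross]; ring

theorem cross_ofReal_mul_right (t : ℝ) (a b : ℂ) : cross a ((t : ℂ) * b) = t * cross a b := by
  simp [cross]; ring

theorem cross_add_right (a b c : ℂ) : cross a (b + c) = cross a b + cross a c := by
  simp [cross]; ring

theorem cross_sub_right (a b c : ℂ) : cross a (b - c) = cross a b - cross a c := by
  simp [cross]; ring

theorem cross_neg_left (a b : ℂ) : cross (-a) b = -cross a b := by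
  simp [cross]; ring

theorem cross_self (a : ℂ) : cross a a = 0 := by
  simp [cross]; ring

theorem cross_comm (a b : ℂ) : cross a b = -cross b a := by
  simp [cross]; ring

theorem cross_sq_add_dot_sq (a b : ℂ) : cross a b ^ 2 + dot a b ^ 2 = ‖a‖ ^ 2 * ‖b‖ ^ 2 := by
  rw [Complex.sq_norm, Complex.normSq_apply, Complex.sq_norm, Complex.normSq_apply]
  simp only [dot, cross]; ring

theorem abs_cross_le (a b : ℂ) : |cross a b| ≤ ‖a‖ * ‖b‖ := by
  apply abs_le_of_sq_le_sq _ (by positivity)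
  nlinarith [cross_sq_add_dot_sq a b, sq_nonneg (dot a b)]

theorem abs_dot_le (a b : ℂ) : |dot a b| ≤ ‖a‖ * ‖b‖ := by
  apply abs_le_of_sq_le_sq _ (by positivity)
  nlinarith [cross_sq_add_dot_sq a b, sq_nonneg (cross a b)]

/-- Coordinates with respect to a unit vector. -/
theorem eq_mul_coords {e : ℂ} (he : ‖e‖ = 1) (z : ℂ) : z = e * (⟨dot e z, cross e z⟩ : ℂ) := by
  have h : e.re * e.re + e.im * e.im = 1 := by
    rw [← Complex.normSq_apply, ← Complex.sq_norm, he]; norm_num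
  apply Complex.ext <;> simp only [dot, cross, Complex.mul_re, Complex.mul_im]
  · linear_combination (-z.re) * h
  · linear_combination (-z.im) * h

theorem cross_unit_mul {e : ℂ} (he : ‖e‖ = 1) (a b : ℂ) : cross (e * a) (e * b) = cross a b := by
  rw [cross_mul_mul, he]; ring

theorem eq_ofReal_mul_of_cross_eq_zero {a b : ℂ} (ha : a ≠ 0) (h : cross a b = 0) :
    ∃ t : ℝ, b = (t : ℂ) * a := by
  have hn : a.re * a.re + a.im * a.im ≠ 0 := by
    rw [← Complex.normSq_apply]; exact (Complex.normSq_pos.2 ha).ne'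
  refine ⟨dot a b / (a.re * a.re + a.im * a.im), ?_⟩
  simp only [cross] at h
  apply Complex.ext <;> simp only [dot, Complex.re_ofReal_mul, Complex.im_ofReal_mul]
  · rw [div_mul_eq_mul_div, eq_div_iff hn]
    linear_combination (-a.im) * h
  · rw [div_mul_eq_mul_div, eq_div_iff hn]
    linear_combination a.re * h

theorem mem_line_iff {a u z : ℂ} (hu : u ≠ 0) : z ∈ line a u ↔ cross u (z - a) = 0 := by
  constructor
  · rintro ⟨t, rfl⟩
    rw [add_sub_cancel_left, cross_ofReal_mul_right, cross_self, mul_zero]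
  · intro h
    obtain ⟨t, ht⟩ := eq_ofReal_mul_of_cross_eq_zero hu h
    exact ⟨t, by rw [← ht]; ring⟩

theorem line_eq_of_mem {a u y : ℂ} (h : y ∈ line a u) : line y u = line a u := by
  obtain ⟨s, rfl⟩ := h
  ext z
  constructor
  · rintro ⟨t, rfl⟩
    exact ⟨s + t, by push_cast; ring⟩
  · rintro ⟨t, rfl⟩
    exact ⟨t - s, by push_cast; ring⟩

theorem line_mul (a u : ℂ) {t : ℝ} (ht : t ≠ 0) : line a ((t : ℂ) * u) = line a u := by
  have ht' : (t : ℂ) ≠ 0 := by exact_mod_cast ht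
  ext z
  constructor
  · rintro ⟨s, rfl⟩
    exact ⟨s * t, by push_cast; ring⟩
  · rintro ⟨s, rfl⟩
    exact ⟨s / t, by push_cast; field_simp⟩

/-- A line is tangent to a circle exactly when the distance of the centre is the radius. -/
theorem exists_isTangentAt_iff {c x u : ℂ} {ρ : ℝ} (hu : u ≠ 0) (hρ : 0 < ρ) :
    (∃ q, IsTangentAt c ρ (line x u) q) ↔ cross u (c - x) ^ 2 = ρ ^ 2 * ‖u‖ ^ 2 := by
  have hu0 : 0 < ‖u‖ := norm_pos_iff.2 hu
  have hlow : ∀ z ∈ line x u, |cross u (c - x)| ≤ ‖u‖ * dist z c := by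
    intro z hz
    rw [mem_line_iff hu] at hz
    have : cross u (c - x) = cross u (c - z) := by
      have : c - x = (c - z) + (z - x) := by ring
      rw [this, cross_add_right, hz, add_zero]
    rw [this, dist_comm, dist_eq_norm]
    exact abs_cross_le _ _
  obtain ⟨z₀, hz₀, hd⟩ : ∃ z₀ ∈ line x u, ‖u‖ * dist z₀ c = |cross u (c - x)| := by
    -- The foot of the perpendicular from c.
    refine ⟨x + ((dot u (c - x) / ‖u‖ ^ 2 : ℝ) : ℂ) * u, ⟨_, rfl⟩, ?_⟩
    have h1 : cross u (x + ((dot u (c - x) / ‖u‖ ^ 2 : ℝ) : ℂ) * u - c) = - cross u (c - x) := by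
      have : x + ((dot u (c - x) / ‖u‖ ^ 2 : ℝ) : ℂ) * u - c
        = ((dot u (c - x) / ‖u‖ ^ 2 : ℝ) : ℂ) * u - (c - x) := by ring
      rw [this, cross_sub_right, cross_ofReal_mul_right, cross_self]; ring
    have h2 : dot u (x + ((dot u (c - x) / ‖u‖ ^ 2 : ℝ) : ℂ) * u - c) = 0 := by
      have h3 : ∀ k : ℝ, dot u (x + (k : ℂ) * u - c) = k * ‖u‖ ^ 2 - dot u (c - x) := by
        intro k
        rw [Complex.sq_norm, Complex.normSq_apply]
        simp [dot]; ring
      rw [h3]; field_simp; ring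
    have h4 := cross_sq_add_dot_sq u (x + ((dot u (c - x) / ‖u‖ ^ 2 : ℝ) : ℂ) * u - c)
    rw [h1, h2] at h4
    rw [dist_eq_norm, ← abs_of_nonneg (show 0 ≤ ‖u‖ * ‖_‖ by positivity)]
    rw [← sq_eq_sq_iff_abs_eq_abs]
    nlinarith [h4]
  have hkey : cross u (c - x) ^ 2 = ρ ^ 2 * ‖u‖ ^ 2 ↔ |cross u (c - x)| = ‖u‖ * ρ := by
    rw [← sq_abs (cross u (c - x))]
    constructor
    · intro h
      exact (sq_eq_sq₀ (abs_nonneg _) (by positivity)).1 (by rw [h]; ring)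
    · intro h
      rw [h]; ring
  rw [hkey]
  constructor
  · rintro ⟨q, hq, hqd, hmin⟩
    refine le_antisymm (by rw [← hqd]; exact hlow q hq) ?_
    rw [← hd]
    exact mul_le_mul_of_nonneg_left (hmin _ hz₀) hu0.le
  · intro h
    have hz : dist z₀ c = ρ := by
      rw [h] at hd; exact mul_left_cancel₀ hu0.ne' hd
    refine ⟨z₀, hz₀, hz, fun z hz' => ?_⟩
    have := hlow z hz'
    rw [h] at this
    exact le_of_mul_le_mul_left this hu0

/-- The radius to the point of contact of a tangent line is orthogonal to the line. -/
theorem IsTangentAt.dot_eq_zero {c x u p : ℂ} {ρ : ℝ} (hu : u ≠ 0) (hρ : 0 < ρ)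
    (h : IsTangentAt c ρ (line x u) p) : dot u (c - p) = 0 := by
  have h1 := (exists_isTangentAt_iff hu hρ).1 ⟨p, h⟩
  have h2 : cross u (c - x) = cross u (c - p) := by
    have : c - x = (c - p) + (p - x) := by ring
    rw [this, cross_add_right, (mem_line_iff hu).1 h.1, add_zero]
  have h3 := cross_sq_add_dot_sq u (c - p)
  have h4 : ‖c - p‖ = ρ := by rw [← dist_eq_norm, dist_comm]; exact h.2.1
  rw [h4, ← h2] at h3
  have : dot u (c - p) ^ 2 = 0 := by linarith
  exact pow_eq_zero_iff (two_ne_zero) |>.1 this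

/-! ### Bodies and their views from outer points. -/

/-- A compact convex plane body of diameter at most `d` containing the disc of radius `κ d` around
the origin. -/
structure IsBody (Q : Set ℂ) (d κ : ℝ) : Prop where
  convex : Convex ℝ Q
  compact : IsCompact Q
  d_pos : 0 < d
  κ_pos : 0 < κ
  κ_le : κ ≤ 1
  norm_sub_le : ∀ z ∈ Q, ∀ w ∈ Q, ‖z - w‖ ≤ d
  mem_of_norm_le : ∀ z : ℂ, ‖z‖ ≤ κ * d → z ∈ Q

namespace IsBody

variable {Q : Set ℂ} {d κ : ℝ}

theorem zero_mem (hQ : IsBody Q d κ) : (0 : ℂ) ∈ Q :=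
  hQ.mem_of_norm_le 0 (by simpa using (mul_pos hQ.κ_pos hQ.d_pos).le)

theorem norm_le (hQ : IsBody Q d κ) {z : ℂ} (hz : z ∈ Q) : ‖z‖ ≤ d := by
  simpa using hQ.norm_sub_le z hz 0 hQ.zero_mem

/-- The origin lies at distance at least `κ d` from any line keeping the body on one side. -/
theorem le_cross (hQ : IsBody Q d κ) {e a : ℂ} (he : ‖e‖ = 1)
    (h : ∀ z ∈ Q, 0 ≤ cross e (z - a)) : κ * d ≤ cross e (0 - a) := by
  have hpos := mul_pos hQ.κ_pos hQ.d_pos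
  have h1 := h (((-(κ * d) : ℝ) : ℂ) * (e * Complex.I)) (hQ.mem_of_norm_le _ (by
    rw [norm_mul, norm_mul, he, Complex.norm_I, Complex.norm_real, Real.norm_eq_abs, abs_neg,
      abs_of_pos hpos]; linarith))
  rw [cross_sub_right, cross_ofReal_mul_right] at h1
  have h2 : cross e (e * Complex.I) = 1 := by
    have := cross_unit_mul he 1 Complex.I
    rw [mul_one] at this
    rw [this]; simp [cross]
  rw [cross_sub_right]
  have h3 : cross e 0 = 0 := by simp [cross]
  rw [h2] at h1
  linarith

theorem not_collinear (hQ : IsBody Q d κ) {u a : ℂ} (hu : u ≠ 0) :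
    ¬ ∀ z ∈ Q, cross u (z - a) = 0 := by
  intro h
  have hn : 0 < ‖u‖ := norm_pos_iff.2 hu
  have hcr : ∀ z ∈ Q, cross ((‖u‖⁻¹ : ℝ) * u) (z - a) = 0 := by
    intro z hz
    rw [cross_ofReal_mul_left, h z hz, mul_zero]
  have h1 := hQ.le_cross (e := (‖u‖⁻¹ : ℝ) * u) (a := a) (by
    rw [norm_mul, Complex.norm_real, norm_inv, norm_norm, inv_mul_cancel₀ hn.ne'])
    (fun z hz => (hcr z hz).ge)
  rw [hcr 0 hQ.zero_mem] at h1
  linarith [mul_pos hQ.κ_pos hQ.d_pos]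

end IsBody

/-- The view of `Q` from an outer point `x`: the support lines through `x` have the unit directions
`e` (on the right, contact point `p` at distance `t`) and `e * exp (α * I)` (on the left, contact
point `q` at distance `s`). -/
structure View (Q : Set ℂ) (x e : ℂ) (α : ℝ) (q p : ℂ) (s t : ℝ) : Prop where
  norm_e : ‖e‖ = 1
  α_pos : 0 < α
  α_lt : α < Real.pi
  hq : q ∈ Q
  hp : p ∈ Q
  s_pos : 0 < s
  t_pos : 0 < t
  q_eq : q = x + (s : ℂ) * (e * Complex.exp (α * Complex.I))
  p_eq : p = x + (t : ℂ) * e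
  right : ∀ z ∈ Q, 0 ≤ cross e (z - x)
  left : ∀ z ∈ Q, cross (e * Complex.exp (α * Complex.I)) (z - x) ≤ 0

theorem norm_exp_mul_I' (α : ℝ) : ‖Complex.exp (α * Complex.I)‖ = 1 :=
  Complex.norm_exp_ofReal_mul_I α

theorem exp_eq_mk (α : ℝ) : Complex.exp (α * Complex.I) = ⟨Real.cos α, Real.sin α⟩ := by
  apply Complex.ext
  · rw [Complex.exp_ofReal_mul_I_re]
  · rw [Complex.exp_ofReal_mul_I_im]

/-- A point outside a body has a view of it. -/
theorem IsBody.exists_view {Q : Set ℂ} {d κ : ℝ} (hQ : IsBody Q d κ) {x : ℂ} (hx : x ∉ Q) :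
    ∃ e α q p s t, View Q x e α q p s t := by
  obtain ⟨f, u, hfx, hf⟩ := geometric_hahn_banach_point_closed hQ.convex hQ.compact.isClosed hx
  set w : ℂ := ⟨f 1, f Complex.I⟩ with hw
  have hfz : ∀ z, f z = dot w z := by
    intro z
    have : z = z.re • (1 : ℂ) + z.im • Complex.I := by
      apply Complex.ext <;> simp
    conv_lhs => rw [this]
    rw [map_add, map_smul, map_smul]
    simp [dot, hw]; ring
  have hpos : ∀ z ∈ Q, 0 < dot w (z - x) := by
    intro z hz
    rw [← hfz, map_sub]; linarith [hf z hz]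
  -- Since Q lies in an open half plane bounded by a line through x, this slope is defined on Q and
  -- increases with the angle of sight; its extrema are the two contact points.
  have hcont : ContinuousOn (fun z => cross w (z - x) / dot w (z - x)) Q := by
    apply ContinuousOn.div
    · unfold cross; fun_prop
    · unfold dot; fun_prop
    · intro z hz; exact (hpos z hz).ne'
  have hne : Q.Nonempty := ⟨0, hQ.zero_mem⟩
  obtain ⟨p, hp, hpmin⟩ := hQ.compact.exists_isMinOn hne hcont
  obtain ⟨q, hq, hqmax⟩ := hQ.compact.exists_isMaxOn hne hcont
  have key : ∀ a ∈ Q, ∀ b ∈ Q, cross w (a - x) / dot w (a - x) ≤ cross w (b - x) / dot w (b - x) →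
      0 ≤ cross (a - x) (b - x) := by
    intro a ha b hb hab
    rw [div_le_div_iff₀ (hpos a ha) (hpos b hb)] at hab
    have hid : cross (a - x) (b - x) * (w.re ^ 2 + w.im ^ 2)
        = dot w (a - x) * cross w (b - x) - cross w (a - x) * dot w (b - x) := by
      simp only [cross, dot]; ring
    have hw0 : 0 < w.re ^ 2 + w.im ^ 2 := by
      have h1 := hpos a ha
      by_contra hcon
      have h2 : w.re = 0 := by nlinarith [sq_nonneg w.re, sq_nonneg w.im]
      have h3 : w.im = 0 := by nlinarith [sq_nonneg w.re, sq_nonneg w.im]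
      simp [dot, h2, h3] at h1
    by_contra hcon
    nlinarith
  have hR : ∀ z ∈ Q, 0 ≤ cross (p - x) (z - x) := fun z hz => key p hp z hz (hpmin hz)
  have hL : ∀ z ∈ Q, 0 ≤ cross (z - x) (q - x) := fun z hz => key z hz q hq (hqmax hz)
  have hpx : p - x ≠ 0 := fun h => hx (by rwa [← sub_eq_zero.1 h])
  have hqx : q - x ≠ 0 := fun h => hx (by rwa [← sub_eq_zero.1 h])
  have ht : 0 < ‖p - x‖ := norm_pos_iff.2 hpx
  have hs : 0 < ‖q - x‖ := norm_pos_iff.2 hqx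
  have hpq : 0 < cross (p - x) (q - x) := by
    -- If the two extreme rays coincided, Q would lie on a line.
    refine lt_of_le_of_ne (hR q hq) (fun h0 => ?_)
    obtain ⟨k, hk⟩ := eq_ofReal_mul_of_cross_eq_zero hpx h0.symm
    have hkpos : 0 < k := by
      have h1 := hpos q hq
      rw [hk] at h1
      have h2 : dot w (k * (p - x)) = k * dot w (p - x) := by simp [dot]; ring
      rw [h2] at h1
      exact pos_of_mul_pos_left h1 (hpos p hp).le
    refine hQ.not_collinear hpx (a := x) (fun z hz => le_antisymm ?_ (hR z hz))
    have h3 := hL z hz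
    rw [hk, cross_ofReal_mul_right, cross_comm] at h3
    nlinarith
  set e : ℂ := (‖p - x‖⁻¹ : ℝ) * (p - x) with he
  set e₁ : ℂ := (‖q - x‖⁻¹ : ℝ) * (q - x) with he₁
  have hen : ‖e‖ = 1 := by
    rw [he, norm_mul, Complex.norm_real, norm_inv, norm_norm, inv_mul_cancel₀ ht.ne']
  have hen₁ : ‖e₁‖ = 1 := by
    rw [he₁, norm_mul, Complex.norm_real, norm_inv, norm_norm, inv_mul_cancel₀ hs.ne']
  have he0 : e ≠ 0 := by rw [← norm_pos_iff, hen]; exact one_pos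
  have hcr : 0 < cross e e₁ := by
    rw [he, he₁, cross_ofReal_mul_left, cross_ofReal_mul_right]; positivity
  have hcoord := eq_mul_coords hen e₁
  have hdiv : e₁ / e = ⟨dot e e₁, cross e e₁⟩ := by
    rw [div_eq_iff he0, mul_comm]; exact hcoord
  have hexp : e * Complex.exp ((e₁ / e).arg * Complex.I) = e₁ := by
    have h1 := Complex.norm_mul_exp_arg_mul_I (e₁ / e)
    rw [norm_div, hen, hen₁] at h1
    norm_num at h1
    rw [h1]; field_simp
  refine ⟨e, (e₁ / e).arg, q, p, ‖q - x‖, ‖p - x‖, hen, ?_, ?_, hq, hp, hs, ht, ?_, ?_, ?_, ?_⟩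
  · have h0 : 0 ≤ (e₁ / e).arg := Complex.arg_nonneg_iff.2 (by rw [hdiv]; exact hcr.le)
    refine lt_of_le_of_ne h0 (fun h => ?_)
    have := (Complex.arg_eq_zero_iff.1 h.symm).2
    rw [hdiv] at this; exact hcr.ne' this
  · refine lt_of_le_of_ne (Complex.arg_le_pi _) (fun h => ?_)
    have := (Complex.arg_eq_pi_iff.1 h).2
    rw [hdiv] at this; exact hcr.ne' this
  · rw [hexp, he₁, ← mul_assoc, ← Complex.ofReal_mul, mul_inv_cancel₀ hs.ne']; simp
  · rw [he, ← mul_assoc, ← Complex.ofReal_mul, mul_inv_cancel₀ ht.ne']; simp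
  · intro z hz
    rw [he, cross_ofReal_mul_left]
    exact mul_nonneg (by positivity) (hR z hz)
  · intro z hz
    rw [hexp, he₁, cross_ofReal_mul_left, cross_comm]
    have := mul_nonneg (inv_nonneg.2 hs.le) (hL z hz)
    linarith

theorem mem_of_opposite {Q : Set ℂ} (hQ : Convex ℝ Q) {x v : ℂ} {a b : ℝ} (ha : 0 < a) (hb : 0 < b)
    (h₁ : x + (a : ℂ) * v ∈ Q) (h₂ : x - (b : ℂ) * v ∈ Q) : x ∈ Q := by
  have h := hQ h₁ h₂ (show 0 ≤ b / (a + b) by positivity) (show 0 ≤ a / (a + b) by positivity)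
    (by field_simp; ring)
  have hab : ((a : ℂ) + b) ≠ 0 := by exact_mod_cast (show a + b ≠ 0 by positivity)
  have hx : (b / (a + b)) • (x + (a : ℂ) * v) + (a / (a + b)) • (x - (b : ℂ) * v) = x := by
    simp only [Complex.real_smul]
    push_cast
    field_simp
    ring
  rwa [hx] at h

/-- A point of the body on a support line is not an interior point. -/
theorem not_mem_interior_of_cross_eq_zero {Q : Set ℂ} {e x w : ℂ} (he : e ≠ 0)
    (h : ∀ z ∈ Q, 0 ≤ cross e (z - x)) (hw : cross e (w - x) = 0) : w ∉ interior Q := by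
  intro hi
  rw [mem_interior_iff_mem_nhds, Metric.mem_nhds_iff] at hi
  obtain ⟨ε, hε, hb⟩ := hi
  have hn : 0 < ‖e‖ := norm_pos_iff.2 he
  have h1 := h (w + ((-(ε / (2 * ‖e‖)) : ℝ) : ℂ) * (e * Complex.I)) (hb (by
    rw [Metric.mem_ball, dist_eq_norm, add_sub_cancel_left, norm_mul, norm_mul, Complex.norm_I,
      Complex.norm_real, Real.norm_eq_abs, abs_neg, abs_of_pos (by positivity)]
    field_simp
    linarith))
  have h2 : w + ((-(ε / (2 * ‖e‖)) : ℝ) : ℂ) * (e * Complex.I) - x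
    = (w - x) + ((-(ε / (2 * ‖e‖)) : ℝ) : ℂ) * (e * Complex.I) := by ring
  have h3 : cross e (e * Complex.I) = ‖e‖ ^ 2 := by
    have := cross_mul_mul e 1 Complex.I
    rw [mul_one] at this
    rw [this]; simp [cross]
  rw [h2, cross_add_right, hw, cross_ofReal_mul_right, h3] at h1
  have : 0 < ε / (2 * ‖e‖) * ‖e‖ ^ 2 := by positivity
  linarith

/-- By convexity the segment between the two contact points lies in Q, and on a support line it can
only be in the boundary. This is how the nonsingularity of x yields a single contact point on the
right support line. -/
theorem onClockwiseExtension_of_mem {Q : Set ℂ} (hQ : Convex ℝ Q) {x e : ℂ} (hx : x ∉ Q)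
    (he : e ≠ 0) (h : ∀ z ∈ Q, 0 ≤ cross e (z - x)) {a b : ℝ} (ha : 0 < a) (hab : a < b)
    (h₁ : x + (a : ℂ) * e ∈ Q) (h₂ : x + (b : ℂ) * e ∈ Q) : OnClockwiseExtension Q x := by
  have hba : ((b : ℂ) - a) ≠ 0 := by exact_mod_cast (sub_pos.2 hab).ne'
  have hd : x + (b : ℂ) * e - (x + (a : ℂ) * e) = ((b - a : ℝ) : ℂ) * e := by push_cast; ring
  refine ⟨hx, x + a * e, x + b * e, ?_, ?_, ?_, a / (b - a), div_pos ha (sub_pos.2 hab), ?_⟩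
  · intro heq
    have : x + (b : ℂ) * e - (x + (a : ℂ) * e) = 0 := by rw [heq]; ring
    rw [hd] at this
    push_cast at this
    exact (mul_ne_zero hba he) this
  · intro w hw
    refine ⟨subset_closure (hQ.segment_subset h₁ h₂ hw), ?_⟩
    refine not_mem_interior_of_cross_eq_zero he h ?_
    obtain ⟨m, n, -, -, hmn, rfl⟩ := hw
    have : m • (x + (a : ℂ) * e) + n • (x + (b : ℂ) * e) - x = ((m * a + n * b : ℝ) : ℂ) * e := by
      simp only [Complex.real_smul]
      have hmn' : (m : ℂ) + n = 1 := by exact_mod_cast hmn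
      push_cast
      linear_combination x * hmn'
    rw [this, cross_ofReal_mul_right, cross_self, mul_zero]
  · intro z hz
    rw [hd, cross_ofReal_mul_left]
    refine mul_nonneg (sub_pos.2 hab).le ?_
    have : z - (x + (a : ℂ) * e) = (z - x) - (a : ℂ) * e := by ring
    rw [this, cross_sub_right, cross_ofReal_mul_right, cross_self, mul_zero, sub_zero]
    exact h z hz
  · rw [hd]; push_cast; field_simp; ring

/-! ### The auxiliary circle in the coordinates of a view. -/

namespace View

variable {Q : Set ℂ} {d κ : ℝ} {x e : ℂ} {α : ℝ} {q p : ℂ} {s t : ℝ}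

theorem e_ne_zero (V : View Q x e α q p s t) : e ≠ 0 := by
  rw [← norm_pos_iff, V.norm_e]; exact one_pos

theorem sin_pos (V : View Q x e α q p s t) : 0 < Real.sin α :=
  Real.sin_pos_of_pos_of_lt_pi V.α_pos V.α_lt

theorem one_add_cos_pos (V : View Q x e α q p s t) : 0 < 1 + Real.cos α := by
  have h := Real.cos_lt_cos_of_nonneg_of_le_pi V.α_pos.le le_rfl V.α_lt
  rw [Real.cos_pi] at h; linarith

theorem e₁_ne_zero (V : View Q x e α q p s t) : e * Complex.exp (α * Complex.I) ≠ 0 :=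
  mul_ne_zero V.e_ne_zero (Complex.exp_ne_zero _)

theorem norm_e₁ (V : View Q x e α q p s t) : ‖e * Complex.exp (α * Complex.I)‖ = 1 := by
  rw [norm_mul, V.norm_e, norm_exp_mul_I', one_mul]

/-- The right support line meets the body in one point only. -/
theorem eq_contact (V : View Q x e α q p s t) (hQ : Convex ℝ Q) (hx : x ∉ Q)
    (hcl : ¬ OnClockwiseExtension Q x) {z : ℂ} (hz : z ∈ Q) (h : cross e (z - x) = 0) : z = p := by
  obtain ⟨k, hk⟩ := eq_ofReal_mul_of_cross_eq_zero V.e_ne_zero h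
  have hz' : z = x + (k : ℂ) * e := by rw [← hk]; ring
  have hp := V.hp
  rw [V.p_eq] at hp
  have hkpos : 0 < k := by
    rcases lt_trichotomy k 0 with hk0 | hk0 | hk0
    · refine absurd (mem_of_opposite hQ V.t_pos (neg_pos.2 hk0) hp ?_) hx
      push_cast
      rw [neg_mul, sub_neg_eq_add, ← hz']; exact hz
    · rw [hk0] at hz'; simp at hz'; exact absurd (hz' ▸ hz) hx
    · exact hk0
  rw [hz'] at hz
  rcases lt_trichotomy k t with hkt | hkt | hkt
  · exact absurd (onClockwiseExtension_of_mem hQ hx V.e_ne_zero V.right hkpos hkt hz hp) hcl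
  · rw [hz', V.p_eq, hkt]
  · exact absurd (onClockwiseExtension_of_mem hQ hx V.e_ne_zero V.right V.t_pos hkt hp hz) hcl

theorem cross_sub_p (V : View Q x e α q p s t) (z : ℂ) : cross e (z - x) = cross e (z - p) := by
  have : z - x = (z - p) + (t : ℂ) * e := by rw [V.p_eq]; ring
  rw [this, cross_add_right, cross_ofReal_mul_right, cross_self]; ring

theorem cross_nonneg (V : View Q x e α q p s t) {z : ℂ} (hz : z ∈ Q) : 0 ≤ cross e (z - p) := by
  rw [← V.cross_sub_p]; exact V.right z hz

theorem cross_e₁ (V : View Q x e α q p s t) (z : ℂ) :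
    cross (e * Complex.exp (α * Complex.I)) (z - x)
      = Real.cos α * cross e (z - p) - Real.sin α * (t + dot e (z - p)) := by
  have h1 : z - x = e * (⟨t + dot e (z - p), cross e (z - p)⟩ : ℂ) := by
    have h2 : (⟨t + dot e (z - p), cross e (z - p)⟩ : ℂ)
        = t + (⟨dot e (z - p), cross e (z - p)⟩ : ℂ) := by
      apply Complex.ext <;> simp
    rw [h2, mul_add, ← eq_mul_coords V.norm_e (z - p), V.p_eq]; ring
  rw [h1, cross_unit_mul V.norm_e, exp_eq_mk]
  simp only [cross]

/-- The auxiliary circle in terms of the view. -/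
theorem aux (V : View Q x e α q p s t) (hQ : Convex ℝ Q) (hx : x ∉ Q)
    (hcl : ¬ OnClockwiseExtension Q x) {u₁ u₂ p₀ c : ℂ} {ρ : ℝ}
    (A : IsAuxCircle Q x u₁ u₂ p₀ c ρ) :
    p₀ = p ∧ c = p - (ρ : ℂ) * (e * Complex.I) ∧ ρ * Real.sin α = t * (1 + Real.cos α) ∧
      line x u₁ = line x (e * Complex.exp (α * Complex.I)) ∧ line x u₂ = line x e := by
  have hρ := A.radius_pos
  have hp₀ : p₀ ∈ Q := by
    have : p₀ ∈ line x u₂ ∩ Q := by rw [A.single₂]; rfl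
    exact this.2
  obtain ⟨a, ha, hpa⟩ := A.contact₂
  have hpQ := V.hp
  rw [V.p_eq] at hpQ
  have hqQ := V.hq
  rw [V.q_eq] at hqQ
  have h2 : cross e u₂ = 0 := by
    have h := V.right p₀ hp₀
    rw [hpa, add_sub_cancel_left, cross_ofReal_mul_right] at h
    have h' := A.support₂.2.1 _ hpQ
    rw [add_sub_cancel_left, cross_ofReal_mul_right, cross_comm] at h'
    have h3 : 0 ≤ cross e u₂ := nonneg_of_mul_nonneg_right h ha
    have h4 : 0 ≤ -cross e u₂ := nonneg_of_mul_nonneg_right h' V.t_pos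
    linarith
  obtain ⟨k, rfl⟩ := eq_ofReal_mul_of_cross_eq_zero V.e_ne_zero h2
  have hk : 0 < k := by
    rcases lt_trichotomy k 0 with hk0 | hk0 | hk0
    · refine absurd (mem_of_opposite hQ V.t_pos (mul_pos ha (neg_pos.2 hk0)) hpQ ?_) hx
      push_cast
      rw [hpa] at hp₀
      convert hp₀ using 1; ring
    · exact absurd (by rw [hk0]; simp) A.support₂.1
    · exact hk0
  have hpp : p₀ = p := by
    refine V.eq_contact hQ hx hcl hp₀ ?_
    rw [hpa, add_sub_cancel_left, cross_ofReal_mul_right, cross_ofReal_mul_right, cross_self]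
    ring
  subst hpp
  obtain ⟨b, hb, hbQ⟩ := A.contact₁
  have h1 : cross (e * Complex.exp (α * Complex.I)) u₁ = 0 := by
    have h := V.left _ hbQ
    have h' := A.support₁.2.1 _ hqQ
    have h5 : x - (b : ℂ) * u₁ - x = ((-b : ℝ) : ℂ) * u₁ := by push_cast; ring
    rw [h5, cross_ofReal_mul_right] at h
    rw [add_sub_cancel_left, cross_ofReal_mul_right, cross_comm] at h'
    have h3 : 0 ≤ cross (e * Complex.exp (α * Complex.I)) u₁ := by
      by_contra hcon
      nlinarith
    have h4 := nonneg_of_mul_nonneg_right h' V.s_pos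
    linarith
  obtain ⟨l, rfl⟩ := eq_ofReal_mul_of_cross_eq_zero V.e₁_ne_zero h1
  have hl : l ≠ 0 := by
    rintro rfl
    exact A.support₁.1 (by simp)
  have hY : dot e (c - p₀) = 0 := by
    have h := A.tangent₂.dot_eq_zero A.support₂.1 hρ
    have h3 : dot ((k : ℂ) * e) (c - p₀) = k * dot e (c - p₀) := by simp [dot]; ring
    rw [h3] at h
    exact (mul_eq_zero.1 h).resolve_left hk.ne'
  have hc : cross e (c - p₀) = -ρ := by
    have hop := A.opposite
    rw [cross_ofReal_mul_left, V.cross_sub_p] at hop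
    have hneg : cross e (c - p₀) < 0 := by
      by_contra hcon
      exact absurd hop (not_lt.2 (mul_nonneg hk.le (not_lt.1 hcon)))
    have h3 := cross_sq_add_dot_sq e (c - p₀)
    have h4 : ‖c - p₀‖ = ρ := by rw [← dist_eq_norm, dist_comm]; exact A.tangent₂.2.1
    rw [hY, V.norm_e, h4] at h3
    have h5 : (cross e (c - p₀) + ρ) * (cross e (c - p₀) - ρ) = 0 := by linarith
    rcases mul_eq_zero.1 h5 with h6 | h6 <;> linarith
  refine ⟨rfl, ?_, ?_, line_mul _ _ hl, line_mul _ _ hk.ne'⟩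
  · have h3 := eq_mul_coords V.norm_e (c - p₀)
    rw [hY, hc] at h3
    have h4 : (⟨0, -ρ⟩ : ℂ) = -(ρ : ℂ) * Complex.I := by apply Complex.ext <;> simp
    rw [h4] at h3
    linear_combination h3
  · have h := (exists_isTangentAt_iff A.support₁.1 hρ).1 A.tangent₁
    rw [cross_ofReal_mul_left, V.cross_e₁, hY, hc, norm_mul, V.norm_e₁, Complex.norm_real,
      Real.norm_eq_abs, mul_one, sq_abs, mul_pow, add_zero] at h
    have h3 : (Real.cos α * -ρ - Real.sin α * t) ^ 2 = ρ ^ 2 := by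
      have hl2 : l ^ 2 ≠ 0 := pow_ne_zero 2 hl
      apply mul_left_cancel₀ hl2; linarith
    -- The squared tangency condition allows both signs of the distance from the centre to ℓ₁; the
    -- second factor is positive, so only one sign survives.
    have h4 : (ρ * (1 - Real.cos α) - Real.sin α * t) * (ρ * (1 + Real.cos α) + Real.sin α * t)
        = 0 := by linear_combination -h3
    have h5 : 0 < ρ * (1 + Real.cos α) + Real.sin α * t :=
      add_pos (mul_pos hρ V.one_add_cos_pos) (mul_pos V.sin_pos V.t_pos)
    have h6 := (mul_eq_zero.1 h4).resolve_right h5.ne'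
    have h7 := Real.sin_sq_add_cos_sq α
    have h8 : Real.sin α * (ρ * Real.sin α - t * (1 + Real.cos α)) = 0 := by
      linear_combination ρ * h7 + (1 + Real.cos α) * h6
    linarith [(mul_eq_zero.1 h8).resolve_left V.sin_pos.ne']

/-- Existence is needed to unfold the choices in `T` and `chi`; the radius is t cot(α/2). -/
theorem exists_aux (V : View Q x e α q p s t) (hQ : Convex ℝ Q) (hx : x ∉ Q)
    (hcl : ¬ OnClockwiseExtension Q x) : ∃ c ρ, IsAuxCircle Q x
      (-(e * Complex.exp (α * Complex.I))) e p c ρ := by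
  have hs := V.sin_pos
  set ρ := t * (1 + Real.cos α) / Real.sin α with hρdef
  have hρ : 0 < ρ := div_pos (mul_pos V.t_pos V.one_add_cos_pos) hs
  have hρs : ρ * Real.sin α = t * (1 + Real.cos α) := by rw [hρdef]; field_simp
  have hpx : p - x = (t : ℂ) * e := by rw [V.p_eq]; ring
  have hI : e * Complex.I = e * (⟨0, 1⟩ : ℂ) := by congr 1
  have hcI : cross e (e * Complex.I) = 1 := by
    have h := cross_unit_mul V.norm_e 1 Complex.I
    rw [mul_one] at h; rw [h]; simp [cross]
  have hdI : dot e (e * Complex.I) = 0 := by simp [dot]; ring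
  have hcp : p - (ρ : ℂ) * (e * Complex.I) - p = ((-ρ : ℝ) : ℂ) * (e * Complex.I) := by
    push_cast; ring
  refine ⟨p - (ρ : ℂ) * (e * Complex.I), ρ, ?_⟩
  refine ⟨⟨neg_ne_zero.2 V.e₁_ne_zero, ?_, q, V.hq, ?_⟩, ⟨s, V.s_pos, ?_⟩,
    ⟨V.e_ne_zero, V.right, p, V.hp, t, V.p_eq⟩, ⟨t, V.t_pos, V.p_eq⟩, ?_, hρ, ?_, ?_, ?_⟩
  · intro z hz
    rw [cross_neg_left]; linarith [V.left z hz]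
  · exact ⟨-s, by rw [V.q_eq]; push_cast; ring⟩
  · have h := V.hq
    rw [V.q_eq] at h
    convert h using 1; ring
  · ext z
    constructor
    · rintro ⟨hz, hzQ⟩
      exact V.eq_contact hQ hx hcl hzQ ((mem_line_iff V.e_ne_zero).1 hz)
    · rintro rfl
      exact ⟨⟨t, V.p_eq⟩, V.hp⟩
  · rw [exists_isTangentAt_iff (neg_ne_zero.2 V.e₁_ne_zero) hρ, norm_neg, V.norm_e₁, cross_neg_left,
      V.cross_e₁, hcp, cross_ofReal_mul_right, hcI]
    have h3 : dot e (((-ρ : ℝ) : ℂ) * (e * Complex.I)) = 0 := by simp [dot]; ring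
    rw [h3]
    have h7 := Real.sin_sq_add_cos_sq α
    have h8 : Real.sin α * t = ρ * (1 - Real.cos α) := by
      have h9 : (1 + Real.cos α) * (Real.sin α * t - ρ * (1 - Real.cos α)) = 0 := by
        linear_combination ρ * h7 - Real.sin α * hρs
      linarith [(mul_eq_zero.1 h9).resolve_left V.one_add_cos_pos.ne']
    have h10 : -(Real.cos α * (-ρ * 1) - Real.sin α * (t + 0)) = ρ := by linarith
    rw [h10]; ring
  · refine ⟨⟨t, V.p_eq⟩, ?_, ?_⟩
    · rw [dist_comm, dist_eq_norm, hcp, norm_mul, norm_mul, V.norm_e, Complex.norm_I,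
        Complex.norm_real, Real.norm_eq_abs, abs_neg, abs_of_pos hρ]; ring
    · intro z hz
      have h := abs_cross_le e (z - (p - (ρ : ℂ) * (e * Complex.I)))
      have h1 : z - (p - (ρ : ℂ) * (e * Complex.I)) = (z - p) + (ρ : ℂ) * (e * Complex.I) := by ring
      rw [V.norm_e, one_mul, ← dist_eq_norm, h1, cross_add_right, cross_ofReal_mul_right, hcI,
        ← V.cross_sub_p, (mem_line_iff V.e_ne_zero).1 hz] at h
      have := le_abs_self (0 + ρ * 1)
      linarith
  · rw [V.cross_sub_p, hcp, cross_ofReal_mul_right, hcI]; linarith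

end View

/-! ### The image point and its view. -/

/-- Rational parametrization of `cos` and `sin` by the tangent `t / ρ` of the half angle. -/
theorem half_angle {α ρ t : ℝ} (hρ : 0 < ρ) (hc : 0 < 1 + Real.cos α)
    (h : ρ * Real.sin α = t * (1 + Real.cos α)) :
    Real.cos α * (ρ ^ 2 + t ^ 2) = ρ ^ 2 - t ^ 2 ∧ Real.sin α * (ρ ^ 2 + t ^ 2) = 2 * ρ * t := by
  have h7 := Real.sin_sq_add_cos_sq α
  have h1 : ρ ^ 2 * (1 - Real.cos α) = t ^ 2 * (1 + Real.cos α) := by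
    apply mul_left_cancel₀ hc.ne'
    linear_combination (ρ * Real.sin α + t * (1 + Real.cos α)) * h - ρ ^ 2 * h7
  have h2 : Real.cos α * (ρ ^ 2 + t ^ 2) = ρ ^ 2 - t ^ 2 := by linarith
  refine ⟨h2, ?_⟩
  apply mul_left_cancel₀ hρ.ne'
  linear_combination (ρ ^ 2 + t ^ 2) * h + t * h2

theorem exists_half_angle {ρ σ : ℝ} (hρ : 0 < ρ) (hσ : 0 < σ) :
    ∃ β : ℝ, 0 < β ∧ β < Real.pi ∧ Real.cos β * (ρ ^ 2 + σ ^ 2) = ρ ^ 2 - σ ^ 2 ∧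
      Real.sin β * (ρ ^ 2 + σ ^ 2) = 2 * ρ * σ ∧
      ρ * Real.sin β = σ * (1 + Real.cos β) := by
  have h1 := Real.arctan_pos.2 (div_pos hσ hρ)
  have h2 := Real.arctan_lt_pi_div_two (σ / ρ)
  have hc : Real.cos (Real.arctan (σ / ρ)) ≠ 0 := (Real.cos_arctan_pos _).ne'
  have hs : Real.sin (Real.arctan (σ / ρ)) = σ / ρ * Real.cos (Real.arctan (σ / ρ)) := by
    have := Real.tan_arctan (σ / ρ)
    rw [Real.tan_eq_sin_div_cos, div_eq_iff hc] at this
    exact this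
  have h3 : ρ * Real.sin (2 * Real.arctan (σ / ρ))
      = σ * (1 + Real.cos (2 * Real.arctan (σ / ρ))) := by
    rw [Real.sin_two_mul, Real.cos_two_mul, hs]
    field_simp
    ring
  have h4 : 0 < 1 + Real.cos (2 * Real.arctan (σ / ρ)) := by
    rw [Real.cos_two_mul]
    have : 0 < Real.cos (Real.arctan (σ / ρ)) := Real.cos_arctan_pos _
    nlinarith [pow_pos this 2]
  obtain ⟨h5, h6⟩ := half_angle hρ h4 h3
  exact ⟨_, by linarith, by linarith, h5, h6, h3⟩

theorem exp_neg_eq_mk (β : ℝ) :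
    Complex.exp (((-β : ℝ) : ℂ) * Complex.I) = ⟨Real.cos β, -Real.sin β⟩ := by
  rw [exp_eq_mk, Real.cos_neg, Real.sin_neg]

namespace View

variable {Q : Set ℂ} {d κ : ℝ} {x e : ℂ} {α : ℝ} {q p : ℂ} {s t : ℝ}

/-- Multiplying the left support inequality by ρ² + t² makes it polynomial. It is the inequality
`hF` of `next_of_quad` at σ = -t, which lets ℓ₁ and ℓ₃ be compared. -/
theorem left_quad (V : View Q x e α q p s t) {ρ : ℝ} (hρ : 0 < ρ)
    (h : ρ * Real.sin α = t * (1 + Real.cos α)) {z : ℂ} (hz : z ∈ Q) :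
    0 ≤ 2 * ρ * t ^ 2 + 2 * ρ * t * dot e (z - p) - (ρ ^ 2 - t ^ 2) * cross e (z - p) := by
  obtain ⟨h1, h2⟩ := half_angle hρ V.one_add_cos_pos h
  have h3 := V.left z hz
  rw [V.cross_e₁] at h3
  have h4 : 0 < ρ ^ 2 + t ^ 2 := by positivity
  have h5 := mul_nonneg h4.le (neg_nonneg.2 h3)
  have h6 : (ρ ^ 2 + t ^ 2) * -(Real.cos α * cross e (z - p) - Real.sin α * (t + dot e (z - p)))
      = 2 * ρ * t ^ 2 + 2 * ρ * t * dot e (z - p) - (ρ ^ 2 - t ^ 2) * cross e (z - p) := by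
    linear_combination (-cross e (z - p)) * h1 + (t + dot e (z - p)) * h2
  linarith

theorem left_quad_eq (V : View Q x e α q p s t) {ρ : ℝ} (hρ : 0 < ρ)
    (h : ρ * Real.sin α = t * (1 + Real.cos α)) :
    2 * ρ * t ^ 2 + 2 * ρ * t * dot e (q - p) - (ρ ^ 2 - t ^ 2) * cross e (q - p) = 0 := by
  obtain ⟨h1, h2⟩ := half_angle hρ V.one_add_cos_pos h
  have h3 := V.cross_e₁ q
  have h4 : q - x = (s : ℂ) * (e * Complex.exp (α * Complex.I)) := by rw [V.q_eq]; ring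
  rw [h4, cross_ofReal_mul_right, cross_self, mul_zero] at h3
  linear_combination cross e (q - p) * h1 - (t + dot e (q - p)) * h2 + (ρ ^ 2 + t ^ 2) * h3

theorem cross_q (V : View Q x e α q p s t) : cross e (q - p) = s * Real.sin α := by
  have h4 : q - x = (s : ℂ) * (e * Complex.exp (α * Complex.I)) := by rw [V.q_eq]; ring
  rw [← V.cross_sub_p, h4, cross_ofReal_mul_right]
  have h := cross_unit_mul V.norm_e 1 (Complex.exp (α * Complex.I))
  rw [mul_one] at h
  rw [h, exp_eq_mk]
  simp [cross]

theorem dot_p_sub_p (e p : ℂ) : dot e (p - p) = 0 := by simp [dot]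

theorem cross_p_sub_p (e p : ℂ) : cross e (p - p) = 0 := by simp [cross]

/-- The view of `Q` from a point beyond the contact point, when the second support line is tangent
to the circle of radius `ρ`. -/
theorem next_of_quad (V : View Q x e α q p s t) (hQ : Convex ℝ Q) (hx : x ∉ Q)
    (hcl : ¬ OnClockwiseExtension Q x) {ρ σ : ℝ} (hρ : 0 < ρ) (hσ : 0 < σ)
    (hF : ∀ z ∈ Q, 0 ≤ 2 * ρ * σ ^ 2 - 2 * ρ * σ * dot e (z - p)
      - (ρ ^ 2 - σ ^ 2) * cross e (z - p)) {z₀ : ℂ} (hz₀ : z₀ ∈ Q)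
    (hF₀ : 2 * ρ * σ ^ 2 - 2 * ρ * σ * dot e (z₀ - p) - (ρ ^ 2 - σ ^ 2) * cross e (z₀ - p) = 0) :
    ∃ β t', View Q (p + (σ : ℂ) * e) (-(e * Complex.exp (((-β : ℝ) : ℂ) * Complex.I))) β p z₀ σ t' ∧
      ρ * Real.sin β = σ * (1 + Real.cos β) := by
  obtain ⟨β, hβ, hβπ, hc, hs, hρβ⟩ := exists_half_angle hρ hσ
  have hsin := Real.sin_pos_of_pos_of_lt_pi hβ hβπ
  have hn : 0 < ρ ^ 2 + σ ^ 2 := by positivity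
  set e' := -(e * Complex.exp (((-β : ℝ) : ℂ) * Complex.I)) with he'
  have hne' : ‖e'‖ = 1 := by
    rw [he', norm_neg, norm_mul, V.norm_e, norm_exp_mul_I', one_mul]
  have hback : e' * Complex.exp (β * Complex.I) = -e := by
    rw [he', neg_mul, mul_assoc, ← Complex.exp_add]; simp
  have hsub : ∀ z, z - (p + (σ : ℂ) * e) = e * (⟨dot e (z - p) - σ, cross e (z - p)⟩ : ℂ) := by
    intro z
    have h2 : (⟨dot e (z - p) - σ, cross e (z - p)⟩ : ℂ)
        = (⟨dot e (z - p), cross e (z - p)⟩ : ℂ) - σ := by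
      apply Complex.ext <;> simp
    rw [h2, mul_sub, ← eq_mul_coords V.norm_e (z - p)]; ring
  have hcr : ∀ z, (ρ ^ 2 + σ ^ 2) * cross e' (z - (p + (σ : ℂ) * e))
      = 2 * ρ * σ ^ 2 - 2 * ρ * σ * dot e (z - p) - (ρ ^ 2 - σ ^ 2) * cross e (z - p) := by
    intro z
    rw [hsub, he', cross_neg_left, cross_unit_mul V.norm_e, exp_neg_eq_mk]
    simp only [cross]
    linear_combination (-(e.re * (z - p).im - e.im * (z - p).re)) * hc
      - (dot e (z - p) - σ) * hs
  have hY₀ : 0 < cross e (z₀ - p) := by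
    refine lt_of_le_of_ne (V.cross_nonneg hz₀) (fun h0 => ?_)
    have hz : z₀ = p := V.eq_contact hQ hx hcl hz₀ (by rw [V.cross_sub_p]; exact h0.symm)
    rw [hz, dot_p_sub_p, cross_p_sub_p] at hF₀
    have : 0 < 2 * ρ * σ ^ 2 := by positivity
    linarith
  have hline : cross e' (z₀ - (p + (σ : ℂ) * e)) = 0 := by
    have h := hcr z₀
    rw [hF₀] at h
    exact (mul_eq_zero.1 h).resolve_left hn.ne'
  have he'0 : e' ≠ 0 := by rw [← norm_pos_iff, hne']; exact one_pos
  obtain ⟨k, hk⟩ := eq_ofReal_mul_of_cross_eq_zero he'0 hline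
  have hkpos : 0 < k := by
    have h1 : cross e (z₀ - (p + (σ : ℂ) * e)) = cross e (z₀ - p) := by
      have : z₀ - (p + (σ : ℂ) * e) = (z₀ - p) - (σ : ℂ) * e := by ring
      rw [this, cross_sub_right, cross_ofReal_mul_right, cross_self]; ring
    have h2 : cross e e' = Real.sin β := by
      rw [he', cross_comm, cross_neg_left, neg_neg]
      have h := cross_unit_mul V.norm_e (Complex.exp (((-β : ℝ) : ℂ) * Complex.I)) 1
      rw [mul_one] at h
      rw [h, exp_neg_eq_mk]; simp [cross]
    rw [hk, cross_ofReal_mul_right, h2] at h1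
    exact pos_of_mul_pos_left (h1 ▸ hY₀) hsin.le
  refine ⟨β, k, ⟨hne', hβ, hβπ, V.hp, hz₀, hσ, hkpos, ?_, ?_, ?_, ?_⟩, hρβ⟩
  · rw [hback]; ring
  · rw [← hk]; ring
  · intro z hz
    have h := hF z hz
    rw [← hcr z] at h
    exact nonneg_of_mul_nonneg_right h hn
  · intro z hz
    rw [hback, cross_neg_left]
    have : z - (p + (σ : ℂ) * e) = (z - p) - (σ : ℂ) * e := by ring
    rw [this, cross_sub_right, cross_ofReal_mul_right, cross_self]
    linarith [V.cross_nonneg hz]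

/-- An image of `x` lies beyond the contact point, and the third support line provides the view
from the image. -/
theorem next_of_isImage (V : View Q x e α q p s t) (hQ : Convex ℝ Q) (hx : x ∉ Q)
    (hcl : ¬ OnClockwiseExtension Q x) {y : ℂ} (hy : IsImage Q x y) :
    ∃ (ρ σ β : ℝ) (p' : ℂ) (t' : ℝ), 0 < ρ ∧ y = p + (σ : ℂ) * e ∧
      View Q y (-(e * Complex.exp (((-β : ℝ) : ℂ) * Complex.I))) β p p' σ t' ∧
      ρ * Real.sin α = t * (1 + Real.cos α) ∧ ρ * Real.sin β = σ * (1 + Real.cos β) := by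
  obtain ⟨u₁, u₂, p₀, c, ρ, A, ℓ₃, ⟨a, w, rfl, hw0, hwQ, z₀, hz₀, hz₀l⟩, htan, hne₁, hne₂, hy₂, hy₃⟩
    := hy
  have hρ := A.radius_pos
  obtain ⟨rfl, hc, hα, hl₁, hl₂⟩ := V.aux hQ hx hcl A
  rw [hl₁] at hne₁
  rw [hl₂] at hne₂ hy₂
  have ht := V.t_pos
  obtain ⟨σ, hσ⟩ : ∃ σ : ℝ, y = p₀ + (σ : ℂ) * e := by
    obtain ⟨k, hk⟩ := hy₂
    exact ⟨k - t, by rw [hk, V.p_eq]; push_cast; ring⟩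
  have hya : line y w = line a w := line_eq_of_mem hy₃
  rw [← hya] at htan hne₁ hne₂ hz₀l
  have hwy : ∀ z, cross w (z - a) = cross w (z - y) := by
    intro z
    have h1 := (mem_line_iff hw0).1 hy₃
    have : z - a = (z - y) + (y - a) := by ring
    rw [this, cross_add_right, h1, add_zero]
  -- coordinates of the direction of the third line
  set m := dot e w with hm
  set n := cross e w with hn
  have hw : w = e * (⟨m, n⟩ : ℂ) := eq_mul_coords V.norm_e w
  have hsub : ∀ z, z - y = e * (⟨dot e (z - p₀) - σ, cross e (z - p₀)⟩ : ℂ) := by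
    intro z
    have h2 : (⟨dot e (z - p₀) - σ, cross e (z - p₀)⟩ : ℂ)
        = (⟨dot e (z - p₀), cross e (z - p₀)⟩ : ℂ) - σ := by
      apply Complex.ext <;> simp
    rw [h2, mul_sub, ← eq_mul_coords V.norm_e (z - p₀), hσ]; ring
  have hcw : ∀ z, cross w (z - y) = m * cross e (z - p₀) - n * (dot e (z - p₀) - σ) := by
    intro z
    rw [hsub, hw, cross_unit_mul V.norm_e]
    simp only [cross]
  have hcp : c - y = e * (⟨-σ, -ρ⟩ : ℂ) := by
    have h2 : (⟨-σ, -ρ⟩ : ℂ) = -(σ : ℂ) - (ρ : ℂ) * Complex.I := by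
      apply Complex.ext <;> simp
    rw [h2, hc, hσ]; ring
  have hT := (exists_isTangentAt_iff hw0 hρ).1 htan
  have hnw : ‖w‖ ^ 2 = m ^ 2 + n ^ 2 := by
    have h := cross_sq_add_dot_sq e w
    rw [V.norm_e, ← hm, ← hn] at h
    linarith
  rw [hnw, hcp, hw, cross_unit_mul V.norm_e] at hT
  simp only [cross] at hT
  have hn0 : n ≠ 0 := by
    intro h0
    refine hne₂ ?_
    obtain ⟨k, hk⟩ := eq_ofReal_mul_of_cross_eq_zero V.e_ne_zero (hn.symm.trans h0)
    have hk0 : k ≠ 0 := by rintro rfl; exact hw0 (by rw [hk]; simp)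
    rw [hk, line_mul _ _ hk0]
    exact line_eq_of_mem hy₂
  -- The tangency condition is quadratic in the slope and has ℓ₂ as one root; dividing by n removes
  -- that root, and a linear equation remains.
  have hT' : n * (σ ^ 2 - ρ ^ 2) = 2 * m * σ * ρ := by
    apply mul_left_cancel₀ hn0; linear_combination hT
  have hσ0 : σ ≠ 0 := by
    rintro rfl
    have h1 : n * ρ ^ 2 = 0 := by linear_combination -hT'
    exact (mul_ne_zero hn0 (pow_ne_zero 2 hρ.ne')) h1
  -- the sign of `n` is opposite to that of `σ`
  have hFz : ∀ z, 2 * ρ * σ * cross w (z - y) =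
      n * (2 * ρ * σ ^ 2 - 2 * ρ * σ * dot e (z - p₀) - (ρ ^ 2 - σ ^ 2) * cross e (z - p₀)) := by
    intro z
    rw [hcw]; linear_combination (-cross e (z - p₀)) * hT'
  have hsign : 0 < n * σ := by
    have h1 := hwQ p₀ V.hp
    rw [hwy, hcw, dot_p_sub_p, cross_p_sub_p] at h1
    refine lt_of_le_of_ne (by linarith) (mul_ne_zero hn0 hσ0).symm
  have hF : ∀ z ∈ Q, 0 ≤ 2 * ρ * σ ^ 2 - 2 * ρ * σ * dot e (z - p₀)
      - (ρ ^ 2 - σ ^ 2) * cross e (z - p₀) := by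
    intro z hz
    have h1 := hwQ z hz
    rw [hwy] at h1
    have h2 := hFz z
    have h3 : 0 ≤ (2 * ρ * σ * cross w (z - y)) * σ := by
      have : (2 * ρ * σ * cross w (z - y)) * σ = 2 * ρ * σ ^ 2 * cross w (z - y) := by ring
      rw [this]; positivity
    rw [h2, mul_right_comm] at h3
    exact nonneg_of_mul_nonneg_right h3 hsign
  have hF₀ : 2 * ρ * σ ^ 2 - 2 * ρ * σ * dot e (z₀ - p₀) - (ρ ^ 2 - σ ^ 2) * cross e (z₀ - p₀)
      = 0 := by
    have h1 := (mem_line_iff hw0).1 hz₀l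
    have h2 := hFz z₀
    rw [h1, mul_zero] at h2
    exact (mul_eq_zero.1 h2.symm).resolve_left hn0
  have hY₀ : 0 < cross e (z₀ - p₀) := by
    refine lt_of_le_of_ne (V.cross_nonneg hz₀) (fun h0 => ?_)
    have hz : z₀ = p₀ := V.eq_contact hQ hx hcl hz₀ (by rw [V.cross_sub_p]; exact h0.symm)
    rw [hz, dot_p_sub_p, cross_p_sub_p] at hF₀
    have : 0 < 2 * ρ * σ ^ 2 := by positivity
    linarith
  have hYq : 0 < cross e (q - p₀) := by
    rw [V.cross_q]; exact mul_pos V.s_pos V.sin_pos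
  rcases lt_or_gt_of_ne hσ0 with hneg | hpos
  · exfalso
    -- both lines support `Q` on the left, hence coincide
    have hσt : σ = -t := by
      have ha₀ := V.left_quad hρ hα hz₀
      have haq := V.left_quad_eq hρ hα
      have hFq := hF q V.hq
      set X₀ := dot e (z₀ - p₀)
      set Y₀ := cross e (z₀ - p₀)
      set X := dot e (q - p₀)
      set Y := cross e (q - p₀)
      -- This combination eliminates X. Evaluated at q, where the first form vanishes, and at z₀,
      -- where the second does, it bounds σ + t from both sides.
      have hid : ∀ X Y : ℝ, -σ * (2 * ρ * t ^ 2 + 2 * ρ * t * X - (ρ ^ 2 - t ^ 2) * Y)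
          - t * (2 * ρ * σ ^ 2 - 2 * ρ * σ * X - (ρ ^ 2 - σ ^ 2) * Y)
          = (σ + t) * (2 * ρ * -σ * t + Y * (ρ ^ 2 + -σ * t)) := by
        intro X Y; ring
      have hσ' := neg_pos.2 hneg
      refine le_antisymm ?_ ?_
      · have h1 := hid X Y
        rw [haq] at h1
        have h2 : 0 < 2 * ρ * -σ * t + Y * (ρ ^ 2 + -σ * t) := by positivity
        have h3 := mul_nonneg ht.le hFq
        by_contra hcon
        have h4 : 0 < (σ + t) * (2 * ρ * -σ * t + Y * (ρ ^ 2 + -σ * t)) :=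
          mul_pos (by linarith) h2
        linarith
      · have h1 := hid X₀ Y₀
        rw [hF₀] at h1
        have h2 : 0 < 2 * ρ * -σ * t + Y₀ * (ρ ^ 2 + -σ * t) := by positivity
        have h3 := mul_nonneg hσ'.le ha₀
        by_contra hcon
        have h4 : (σ + t) * (2 * ρ * -σ * t + Y₀ * (ρ ^ 2 + -σ * t)) < 0 :=
          mul_neg_of_neg_of_pos (by linarith) h2
        linarith
    refine hne₁ ?_
    have hyx : y = x := by rw [hσ, V.p_eq, hσt]; push_cast; ring
    obtain ⟨h1, h2⟩ := half_angle hρ V.one_add_cos_pos hα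
    have h3 : cross (e * Complex.exp (α * Complex.I)) w = 0 := by
      rw [hw, cross_unit_mul V.norm_e, exp_eq_mk]
      simp only [cross]
      have h4 : 0 < ρ ^ 2 + t ^ 2 := by positivity
      apply mul_left_cancel₀ h4.ne'
      rw [hσt] at hT'
      linear_combination n * h1 - m * h2 - hT'
    obtain ⟨k, hk⟩ := eq_ofReal_mul_of_cross_eq_zero V.e₁_ne_zero h3
    have hk0 : k ≠ 0 := by rintro rfl; exact hw0 (by rw [hk]; simp)
    rw [hk, line_mul _ _ hk0, hyx]
  · obtain ⟨β, t', hV, hβ⟩ := V.next_of_quad hQ hx hcl hρ hpos hF hz₀ hF₀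
    exact ⟨ρ, σ, β, z₀, t', hρ, hσ, hσ ▸ hV, hα, hβ⟩

/-- The outer length billiard map is defined at `x`. -/
theorem exists_isImage (V : View Q x e α q p s t) (hQ : IsBody Q d κ) (hx : x ∉ Q)
    (hcl : ¬ OnClockwiseExtension Q x) : ∃ y, IsImage Q x y := by
  obtain ⟨c, ρ, A⟩ := V.exists_aux hQ.convex hx hcl
  have hρ := A.radius_pos
  obtain ⟨-, hc, hα, hl₁, -⟩ := V.aux hQ.convex hx hcl A
  -- The larger root in σ of the quadratic form attached to z: where the tangent to the circle
  -- through z meets ℓ₂ beyond p. The third support line passes through the point of Q with the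
  -- largest root.
  set g : ℂ → ℝ := fun z => (ρ * dot e (z - p) + Real.sqrt (ρ ^ 2 * dot e (z - p) ^ 2
    + cross e (z - p) * ρ ^ 2 * (2 * ρ + cross e (z - p)))) / (2 * ρ + cross e (z - p)) with hg
  have hden : ∀ z ∈ Q, 0 < 2 * ρ + cross e (z - p) := by
    intro z hz
    linarith [V.cross_nonneg hz]
  have hcont : ContinuousOn g Q := by
    apply ContinuousOn.div
    · unfold cross dot; fun_prop
    · unfold cross; fun_prop
    · intro z hz; exact (hden z hz).ne'
  obtain ⟨z₀, hz₀, hmax⟩ := hQ.compact.exists_isMaxOn ⟨0, hQ.zero_mem⟩ hcont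
  -- the quadratic form attached to a point is nonnegative beyond the root `g z`
  have hquad : ∀ z ∈ Q, ∀ σ, 2 * ρ * σ ^ 2 - 2 * ρ * σ * dot e (z - p)
      - (ρ ^ 2 - σ ^ 2) * cross e (z - p) = (σ - g z) * ((2 * ρ + cross e (z - p)) * σ
        - ρ * dot e (z - p) + Real.sqrt (ρ ^ 2 * dot e (z - p) ^ 2
          + cross e (z - p) * ρ ^ 2 * (2 * ρ + cross e (z - p)))) := by
    intro z hz σ
    have h1 := hden z hz
    have h2 := V.cross_nonneg hz
    have h3 := Real.sq_sqrt (show 0 ≤ ρ ^ 2 * dot e (z - p) ^ 2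
      + cross e (z - p) * ρ ^ 2 * (2 * ρ + cross e (z - p)) by positivity)
    simp only [hg]
    set R := Real.sqrt (ρ ^ 2 * dot e (z - p) ^ 2
      + cross e (z - p) * ρ ^ 2 * (2 * ρ + cross e (z - p)))
    rw [eq_comm]
    field_simp
    linear_combination -h3
  have hR : ∀ z ∈ Q, ρ * |dot e (z - p)| ≤ Real.sqrt (ρ ^ 2 * dot e (z - p) ^ 2
      + cross e (z - p) * ρ ^ 2 * (2 * ρ + cross e (z - p))) := by
    intro z hz
    have h1 := hden z hz
    have h2 := V.cross_nonneg hz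
    apply Real.le_sqrt_of_sq_le
    rw [mul_pow, sq_abs]
    have : 0 ≤ cross e (z - p) * ρ ^ 2 * (2 * ρ + cross e (z - p)) := by positivity
    linarith
  -- The point q has positive height over ℓ₂, which makes its root positive.
  have hgpos : 0 < g z₀ := by
    have h1 := hmax V.hq
    refine lt_of_lt_of_le ?_ h1
    have hY : 0 < cross e (q - p) := by rw [V.cross_q]; exact mul_pos V.s_pos V.sin_pos
    refine div_pos ?_ (hden q V.hq)
    have h2 : ρ * |dot e (q - p)| < Real.sqrt (ρ ^ 2 * dot e (q - p) ^ 2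
      + cross e (q - p) * ρ ^ 2 * (2 * ρ + cross e (q - p))) := by
      apply Real.lt_sqrt_of_sq_lt
      rw [mul_pow, sq_abs]
      have : 0 < cross e (q - p) * ρ ^ 2 * (2 * ρ + cross e (q - p)) := by positivity
      linarith
    have h3 := mul_le_mul_of_nonneg_left (neg_abs_le (dot e (q - p))) hρ.le
    linarith
  have hF : ∀ z ∈ Q, 0 ≤ 2 * ρ * g z₀ ^ 2 - 2 * ρ * g z₀ * dot e (z - p)
      - (ρ ^ 2 - g z₀ ^ 2) * cross e (z - p) := by
    intro z hz
    rw [hquad z hz]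
    refine mul_nonneg (sub_nonneg.2 (hmax hz)) ?_
    have h1 := hR z hz
    have h2 := mul_le_mul_of_nonneg_left (le_abs_self (dot e (z - p))) hρ.le
    have h3 := mul_pos (hden z hz) hgpos
    linarith
  have hF₀ : 2 * ρ * g z₀ ^ 2 - 2 * ρ * g z₀ * dot e (z₀ - p)
      - (ρ ^ 2 - g z₀ ^ 2) * cross e (z₀ - p) = 0 := by
    rw [hquad z₀ hz₀, sub_self, zero_mul]
  obtain ⟨β, t', W, hβ⟩ := V.next_of_quad hQ.convex hx hcl hρ hgpos hF hz₀ hF₀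
  have hsβ := W.sin_pos
  set y := p + (g z₀ : ℂ) * e with hy
  set e' := -(e * Complex.exp (((-β : ℝ) : ℂ) * Complex.I)) with he'
  have hback : e' * Complex.exp (β * Complex.I) = -e := by
    rw [he', neg_mul, mul_assoc, ← Complex.exp_add]; simp
  have hcre : cross e e' = Real.sin β := by
    have h := cross_unit_mul V.norm_e 1 (Complex.exp (((-β : ℝ) : ℂ) * Complex.I))
    rw [mul_one] at h
    rw [he', cross_comm, cross_neg_left, neg_neg, cross_comm, h, exp_neg_eq_mk]; simp [cross]
  have hyx : y = x + ((t + g z₀ : ℝ) : ℂ) * e := by rw [hy, V.p_eq]; push_cast; ring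
  have hyl₂ : y ∈ line x e := ⟨_, hyx⟩
  refine ⟨y, _, e, p, c, ρ, A, line y e', ⟨y, e', rfl, W.e_ne_zero, W.right, z₀, hz₀, t', W.p_eq⟩,
    ?_, ?_, ?_, hyl₂, 0, by simp⟩
  · rw [exists_isTangentAt_iff W.e_ne_zero hρ, W.norm_e]
    have h2 : c - y = e * (⟨-g z₀, -ρ⟩ : ℂ) := by
      have h2 : (⟨-g z₀, -ρ⟩ : ℂ) = -(g z₀ : ℂ) - (ρ : ℂ) * Complex.I := by
        apply Complex.ext <;> simp
      rw [h2, hc, hy]; ring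
    obtain ⟨h5, h6⟩ := half_angle hρ W.one_add_cos_pos hβ
    rw [h2, he', cross_neg_left, cross_unit_mul V.norm_e, exp_neg_eq_mk]
    simp only [cross]
    have h7 : 0 < ρ ^ 2 + g z₀ ^ 2 := by positivity
    have h8 : -(Real.cos β * -ρ - -Real.sin β * -g z₀) = ρ := by
      apply mul_left_cancel₀ h7.ne'
      linear_combination ρ * h5 + g z₀ * h6
    rw [h8]; ring
  · intro hl
    rw [hl₁] at hl
    -- `x` and `y` would both lie on the line
    have hyl : y ∈ line x (e * Complex.exp (α * Complex.I)) := by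
      rw [← hl]; exact ⟨0, by simp⟩
    rw [mem_line_iff V.e₁_ne_zero, hyx, add_sub_cancel_left, cross_ofReal_mul_right] at hyl
    have h := cross_unit_mul V.norm_e (Complex.exp (α * Complex.I)) 1
    rw [mul_one] at h
    rw [h, exp_eq_mk] at hyl
    simp only [cross, Complex.one_re, Complex.one_im] at hyl
    have := mul_pos (add_pos V.t_pos hgpos) V.sin_pos
    linarith
  · intro hl
    have h1 : y + ((1 : ℝ) : ℂ) * e' ∈ line x e := by rw [← hl]; exact ⟨1, rfl⟩
    rw [mem_line_iff V.e_ne_zero] at h1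
    have h2 : y + ((1 : ℝ) : ℂ) * e' - x = (y - x) + e' := by push_cast; ring
    rw [h2, cross_add_right, (mem_line_iff V.e_ne_zero).1 hyl₂, hcre] at h1
    linarith

/-- `next_of_isImage` describes every image of x, so it applies to the chosen one without a separate
uniqueness argument. -/
theorem T_spec (V : View Q x e α q p s t) (hQ : IsBody Q d κ) (hx : x ∉ Q)
    (hcl : ¬ OnClockwiseExtension Q x) :
    ∃ (ρ σ β : ℝ) (p' : ℂ) (t' : ℝ), 0 < ρ ∧ T Q x = p + (σ : ℂ) * e ∧
      View Q (T Q x) (-(e * Complex.exp (((-β : ℝ) : ℂ) * Complex.I))) β p p' σ t' ∧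
      ρ * Real.sin α = t * (1 + Real.cos α) ∧ ρ * Real.sin β = σ * (1 + Real.cos β) :=
  V.next_of_isImage hQ.convex hx hcl (Classical.epsilon_spec (V.exists_isImage hQ hx hcl))

theorem chi_spec (V : View Q x e α q p s t) (hQ : Convex ℝ Q) (hx : x ∉ Q)
    (hcl : ¬ OnClockwiseExtension Q x) :
    ∃ ρ : ℝ, ρ * Real.sin α = t * (1 + Real.cos α) ∧
      chi Q x = p - (ρ : ℂ) * (e * Complex.I) := by
  obtain ⟨c, ρ, A⟩ := V.exists_aux hQ hx hcl
  obtain ⟨u₁, u₂, p₀, ρ', A'⟩ : ∃ (u₁ u₂ p₀ : ℂ) (ρ : ℝ), IsAuxCircle Q x u₁ u₂ p₀ (chi Q x) ρ :=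
    Classical.epsilon_spec (p := fun c => ∃ (u₁ u₂ p : ℂ) (ρ : ℝ), IsAuxCircle Q x u₁ u₂ p c ρ)
      ⟨c, _, _, _, ρ, A⟩
  obtain ⟨-, hc, hα, -⟩ := V.aux hQ hx hcl A'
  exact ⟨ρ', hα, hc⟩

end View

/-! ### Estimates for one step around a small body. -/

theorem angle_le_of_sin_le {α k : ℝ} (h₀ : 0 < α) (hπ : α < Real.pi) (hc : 0 ≤ Real.cos α)
    (h : Real.sin α ≤ k) : α ≤ 2 * k := by
  have h1 : α ≤ Real.pi / 2 := by
    by_contra hcon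
    exact absurd hc (not_le.2 (Real.cos_neg_of_pi_div_two_lt_of_lt (not_le.1 hcon)
      (by linarith [Real.pi_pos])))
  have h2 := Real.mul_le_sin h₀.le h1
  have h3 : 1 / 2 * α ≤ 2 / Real.pi * α := by
    apply mul_le_mul_of_nonneg_right _ h₀.le
    rw [div_le_div_iff₀ two_pos Real.pi_pos]
    linarith [Real.pi_le_four]
  linarith

theorem half_le_cos {α : ℝ} (hc : 0 ≤ Real.cos α) (hs : 0 ≤ Real.sin α)
    (h : Real.sin α ≤ 1 / 2) : 1 / 2 ≤ Real.cos α := by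
  have h7 := Real.sin_sq_add_cos_sq α
  by_contra hcon
  nlinarith

theorem norm_one_sub_exp_le (α : ℝ) (h : 0 ≤ α) : ‖1 - Complex.exp (α * Complex.I)‖ ≤ α := by
  have h1 := Real.norm_exp_I_mul_ofReal_sub_one_le (x := α)
  rw [norm_sub_rev, mul_comm]
  rwa [Real.norm_eq_abs, abs_of_nonneg h] at h1

theorem cross_sub_add_sub (e a b c : ℂ) : cross e (a - c) = cross e (a - b) + cross e (b - c) := by
  simp only [cross, Complex.sub_re, Complex.sub_im]; ring

theorem dot_sub_add_sub (e a b c : ℂ) : dot e (a - c) = dot e (a - b) + dot e (b - c) := by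
  simp only [dot, Complex.sub_re, Complex.sub_im]; ring

theorem turn_mul_exp (e : ℂ) (β : ℝ) :
    -(e * Complex.exp (((-β : ℝ) : ℂ) * Complex.I)) * Complex.exp (β * Complex.I) = -e := by
  rw [neg_mul, mul_assoc, ← Complex.exp_add]; simp

theorem cross_turn {e : ℂ} (he : ‖e‖ = 1) (β : ℝ) :
    cross e (-(e * Complex.exp (((-β : ℝ) : ℂ) * Complex.I))) = Real.sin β := by
  have h := cross_unit_mul he 1 (Complex.exp (((-β : ℝ) : ℂ) * Complex.I))
  rw [mul_one] at h
  rw [cross_comm, cross_neg_left, neg_neg, cross_comm, h, exp_neg_eq_mk]; simp [cross]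

namespace View

variable {Q : Set ℂ} {d κ : ℝ} {x e : ℂ} {α : ℝ} {q p : ℂ} {s t : ℝ}

theorem norm_q_sub (V : View Q x e α q p s t) : ‖q - x‖ = s := by
  have h4 : q - x = (s : ℂ) * (e * Complex.exp (α * Complex.I)) := by rw [V.q_eq]; ring
  rw [h4, norm_mul, V.norm_e₁, Complex.norm_real, Real.norm_eq_abs, abs_of_pos V.s_pos, mul_one]

theorem norm_p_sub (V : View Q x e α q p s t) : ‖p - x‖ = t := by
  have h4 : p - x = (t : ℂ) * e := by rw [V.p_eq]; ring
  rw [h4, norm_mul, V.norm_e, Complex.norm_real, Real.norm_eq_abs, abs_of_pos V.t_pos, mul_one]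

theorem abs_s_sub_t (V : View Q x e α q p s t) (hQ : IsBody Q d κ) : |s - t| ≤ d := by
  rw [← V.norm_q_sub, ← V.norm_p_sub]
  refine (abs_norm_sub_norm_le _ _).trans ?_
  have : q - x - (p - x) = q - p := by ring
  rw [this]
  exact hQ.norm_sub_le _ V.hq _ V.hp

/-- The law of cosines, in the form expressing `s t (1 + cos α)` through `s + t`. -/
theorem energy_eq (V : View Q x e α q p s t) :
    2 * (s * t * (1 + Real.cos α)) = (s + t) ^ 2 - ‖q - p‖ ^ 2 := by
  have h1 : q - p = e * (⟨s * Real.cos α - t, s * Real.sin α⟩ : ℂ) := by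
    have h2 : (⟨s * Real.cos α - t, s * Real.sin α⟩ : ℂ)
        = s * (⟨Real.cos α, Real.sin α⟩ : ℂ) - t := by
      apply Complex.ext <;> simp
    rw [h2, ← exp_eq_mk, V.p_eq]
    conv_lhs => rw [V.q_eq]
    ring
  rw [h1, norm_mul, V.norm_e, one_mul, Complex.sq_norm, Complex.normSq_mk]
  linear_combination s ^ 2 * Real.sin_sq_add_cos_sq α

/-- The energy controls st, and s and t differ by at most d, so both distances are of order one; a
body of diameter d is then seen under an angle O(d). -/
theorem bounds (V : View Q x e α q p s t) (hQ : IsBody Q d κ) (hd : d ≤ 1 / 8)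
    (h₁ : 1 ≤ s * t * (1 + Real.cos α)) (h₃ : s * t * (1 + Real.cos α) ≤ 3) :
    1 / 2 ≤ s ∧ 1 / 2 ≤ t ∧ t ≤ 2 ∧ 1 / 2 ≤ Real.cos α ∧ Real.sin α ≤ 2 * d ∧ α ≤ 4 * d := by
  have hst := abs_le.1 (V.abs_s_sub_t hQ)
  have hs := V.s_pos
  have ht := V.t_pos
  have hE := V.energy_eq
  have hd0 := hQ.d_pos
  have hn : ‖q - p‖ ≤ d := hQ.norm_sub_le _ V.hq _ V.hp
  have hn0 := norm_nonneg (q - p)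
  have hcos1 := Real.cos_le_one α
  have hst1 : 1 ≤ 2 * (s * t) := by
    have : s * t * (1 + Real.cos α) ≤ s * t * 2 :=
      mul_le_mul_of_nonneg_left (by linarith) (mul_pos hs ht).le
    linarith
  have hs2 : 1 / 2 ≤ s := by
    by_contra hcon
    nlinarith
  have ht2 : 1 / 2 ≤ t := by
    by_contra hcon
    nlinarith
  have hn2 : ‖q - p‖ ^ 2 ≤ d ^ 2 := pow_le_pow_left₀ hn0 hn 2
  have hd2 : d ^ 2 ≤ 1 / 64 := by nlinarith
  have hc : 0 ≤ Real.cos α := by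
    have h1 : 2 * (s * t) * Real.cos α = s ^ 2 + t ^ 2 - ‖q - p‖ ^ 2 := by linarith
    by_contra hcon
    nlinarith [mul_pos hs ht]
  have hsin : Real.sin α ≤ 2 * d := by
    have h1 : s * Real.sin α ≤ d := by
      rw [← V.cross_q]
      refine (le_abs_self _).trans ((abs_cross_le _ _).trans ?_)
      rw [V.norm_e, one_mul]; exact hn
    nlinarith [V.sin_pos]
  have ht3 : t ≤ 2 := by
    by_contra hcon
    have : s * t ≤ 3 := by nlinarith [mul_pos hs ht]
    nlinarith
  refine ⟨hs2, ht2, ht3, half_le_cos hc V.sin_pos.le (by linarith), hsin, ?_⟩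
  have := angle_le_of_sin_le V.α_pos V.α_lt hc hsin
  linarith

/-- Q lies below the left support line through q, whose slope over e is O(d), and its extent along e
is at most d. So q is the highest point up to O(d²). -/
theorem cross_sub_q_le (V : View Q x e α q p s t) (hQ : IsBody Q d κ)
    (hc : 1 / 2 ≤ Real.cos α) (hs : Real.sin α ≤ 2 * d) {z : ℂ} (hz : z ∈ Q) :
    cross e (z - q) ≤ 4 * d ^ 2 := by
  have h1 := V.left z hz
  have h2 : cross (e * Complex.exp (α * Complex.I)) (q - x) = 0 := by
    have h4 : q - x = (s : ℂ) * (e * Complex.exp (α * Complex.I)) := by rw [V.q_eq]; ring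
    rw [h4, cross_ofReal_mul_right, cross_self, mul_zero]
  rw [V.cross_e₁] at h1 h2
  have h3 : cross e (z - p) = cross e (z - q) + cross e (q - p) :=
    cross_sub_add_sub e z q p
  have h4 : dot e (z - p) = dot e (z - q) + dot e (q - p) :=
    dot_sub_add_sub e z q p
  have h5 : dot e (z - q) ≤ d := by
    refine (le_abs_self _).trans ((abs_dot_le _ _).trans ?_)
    rw [V.norm_e, one_mul]; exact hQ.norm_sub_le _ hz _ V.hq
  rw [h3, h4] at h1
  have h6 : Real.cos α * cross e (z - q) ≤ Real.sin α * dot e (z - q) := by linarith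
  have h7 : Real.sin α * dot e (z - q) ≤ Real.sin α * d :=
    mul_le_mul_of_nonneg_left h5 V.sin_pos.le
  have hd0 := hQ.d_pos
  by_contra hcon
  nlinarith

/-- The origin has height at least κd over ℓ₂ and exceeds q by at most 4d² ≤ κd/2. -/
theorem height_ge (V : View Q x e α q p s t) (hQ : IsBody Q d κ) (hd : d ≤ κ / 8)
    (hc : 1 / 2 ≤ Real.cos α) (hs : Real.sin α ≤ 2 * d) : κ * d / 2 ≤ s * Real.sin α := by
  have h1 := V.cross_sub_q_le hQ hc hs hQ.zero_mem
  have h2 := hQ.le_cross V.norm_e (fun z hz => V.cross_nonneg hz)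
  have h3 : cross e (0 - p) = cross e (0 - q) + cross e (q - p) :=
    cross_sub_add_sub e 0 q p
  rw [← V.cross_q]
  have := hQ.d_pos
  nlinarith

/-- Both s and t differ from ‖x‖ by at most d; insert this in `energy_eq`. -/
theorem norm_bound (V : View Q x e α q p s t) (hQ : IsBody Q d κ) :
    |s * t * (1 + Real.cos α) - 2 * ‖x‖ ^ 2| ≤ 4 * ‖x‖ * d + 2 * d ^ 2 := by
  have hE := V.energy_eq
  have hd0 := hQ.d_pos
  have hn : ‖q - p‖ ≤ d := hQ.norm_sub_le _ V.hq _ V.hp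
  have hn2 : ‖q - p‖ ^ 2 ≤ d ^ 2 := pow_le_pow_left₀ (norm_nonneg _) hn 2
  have hn0 := sq_nonneg ‖q - p‖
  have hq := hQ.norm_le V.hq
  have hp := hQ.norm_le V.hp
  have h1 := norm_sub_norm_le x q
  have h2 := norm_sub_norm_le x p
  rw [norm_sub_rev, V.norm_q_sub] at h1
  rw [norm_sub_rev, V.norm_p_sub] at h2
  have h3 := norm_sub_le q x
  have h4 := norm_sub_le p x
  rw [V.norm_q_sub] at h3
  rw [V.norm_p_sub] at h4
  have hx := norm_nonneg x
  have hs := V.s_pos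
  have ht := V.t_pos
  rw [abs_le]
  constructor
  -- Squaring s, t ≥ ‖x‖ - d needs ‖x‖ ≥ d; otherwise positivity of the energy suffices.
  · rcases le_total ‖x‖ d with h | h
    · nlinarith [mul_pos (mul_pos hs ht) V.one_add_cos_pos]
    · have : (2 * (‖x‖ - d)) ^ 2 ≤ (s + t) ^ 2 :=
        pow_le_pow_left₀ (by linarith) (by linarith) 2
      nlinarith
  · have : (s + t) ^ 2 ≤ (2 * (‖x‖ + d)) ^ 2 :=
        pow_le_pow_left₀ (by linarith) (by linarith) 2
    nlinarith

/-- The potential that telescopes along an orbit. -/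
noncomputable def potential (e : ℂ) (α : ℝ) (q p : ℂ) : ℝ :=
  dot e p - dot (e * Complex.exp (α * Complex.I)) q

theorem abs_potential_le (V : View Q x e α q p s t) (hQ : IsBody Q d κ) :
    |potential e α q p| ≤ 2 * d := by
  have h1 := abs_le.1 (abs_dot_le e p)
  have h2 := abs_le.1 (abs_dot_le (e * Complex.exp (α * Complex.I)) q)
  rw [V.norm_e, one_mul] at h1
  rw [V.norm_e₁, one_mul] at h2
  have hq := hQ.norm_le V.hq
  have hp := hQ.norm_le V.hp
  rw [potential, abs_le]
  constructor <;> linarith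

variable {y : ℂ} {ρ σ β t' : ℝ} {p' : ℂ}

theorem cross_next (V : View Q x e α q p s t)
    (W : View Q y (-(e * Complex.exp (((-β : ℝ) : ℂ) * Complex.I))) β p p' σ t') :
    cross e (p' - p) = t' * Real.sin β := by
  have h1 : p' - p = (t' : ℂ) * (-(e * Complex.exp (((-β : ℝ) : ℂ) * Complex.I)))
      + (σ : ℂ) * e := by
    have h2 := W.q_eq
    rw [turn_mul_exp] at h2
    have h3 := W.p_eq
    linear_combination h3 - h2
  rw [h1, cross_add_right, cross_ofReal_mul_right, cross_ofReal_mul_right, cross_self,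
    cross_turn V.norm_e]
  ring

/-- Nothing is known beforehand about the next view. The ratio S'/S = H'/H is at most 2/κ, since
both heights are measured over ℓ₂; this bounds S', hence σ, and ρ ≥ 1/d turns the bound on σ into
smallness of β. -/
theorem step_bounds (V : View Q x e α q p s t) (hQ : IsBody Q d κ) (hd : d ≤ κ / 24)
    (h₁ : 1 ≤ s * t * (1 + Real.cos α)) (h₃ : s * t * (1 + Real.cos α) ≤ 3) (hρ : 0 < ρ)
    (W : View Q y (-(e * Complex.exp (((-β : ℝ) : ℂ) * Complex.I))) β p p' σ t')
    (hα : ρ * Real.sin α = t * (1 + Real.cos α)) (hβ : ρ * Real.sin β = σ * (1 + Real.cos β)) :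
    1 / 2 ≤ Real.cos β ∧ Real.sin β ≤ 12 * d / κ ∧
      (σ * t' * (1 + Real.cos β)) * (s * Real.sin α)
        = (s * t * (1 + Real.cos α)) * (t' * Real.sin β) := by
  have hd0 := hQ.d_pos
  have hκ := hQ.κ_pos
  have hκ1 := hQ.κ_le
  obtain ⟨hs2, ht2, -, hcos, hsin, -⟩ := V.bounds hQ (by linarith) h₁ h₃
  have hH := V.height_ge hQ (by linarith) hcos hsin
  have hs := V.s_pos
  have ht := V.t_pos
  have hσ := W.s_pos
  have ht' := W.t_pos
  have hsα := V.sin_pos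
  have hsβ := W.sin_pos
  set S := s * t * (1 + Real.cos α) with hS
  set S' := σ * t' * (1 + Real.cos β) with hS'
  have hHle : s * Real.sin α ≤ d := by
    rw [← V.cross_q]
    refine (le_abs_self _).trans ((abs_cross_le _ _).trans ?_)
    rw [V.norm_e, one_mul]; exact hQ.norm_sub_le _ V.hq _ V.hp
  have hH'le : t' * Real.sin β ≤ d := by
    rw [← V.cross_next W]
    refine (le_abs_self _).trans ((abs_cross_le _ _).trans ?_)
    rw [V.norm_e, one_mul]; exact hQ.norm_sub_le _ W.hp _ V.hp
  have hρS : ρ * (s * Real.sin α) = S := by rw [hS]; linear_combination s * hα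
  have hρS' : ρ * (t' * Real.sin β) = S' := by rw [hS']; linear_combination t' * hβ
  have hSS : S' * (s * Real.sin α) = S * (t' * Real.sin β) := by
    rw [← hρS, ← hρS']; ring
  have hρd : 1 ≤ ρ * d := h₁.trans (by rw [← hρS]; exact mul_le_mul_of_nonneg_left hHle hρ.le)
  have hS'pos : 0 < S' := by
    rw [← hρS']; positivity
  have hS'le : S' * κ ≤ 6 := by
    have h1 : S' * (κ * d / 2) ≤ 3 * d :=
      (mul_le_mul_of_nonneg_left hH hS'pos.le).trans (by
        rw [hSS]
        exact mul_le_mul h₃ hH'le (by positivity) (by norm_num))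
    have h2 : (S' * κ) * d ≤ 6 * d := by linarith
    exact le_of_mul_le_mul_right h2 hd0
  have hσle : σ * κ ≤ 6 := by
    -- For σ ≥ 1 the law of cosines gives S' ≥ 2σ² - 2σd ≥ σ.
    rcases le_total σ 1 with h | h
    · exact (mul_le_one₀ h hκ.le hκ1).trans (by norm_num)
    · have h1 := W.energy_eq
      have h2 := abs_le.1 (W.abs_s_sub_t hQ)
      have h3 : ‖p - p'‖ ^ 2 ≤ d ^ 2 :=
        pow_le_pow_left₀ (norm_nonneg _) (hQ.norm_sub_le _ V.hp _ W.hp) 2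
      have h4 : (2 * σ - d) ^ 2 ≤ (σ + t') ^ 2 :=
        pow_le_pow_left₀ (by linarith) (by linarith) 2
      have h5 : σ ≤ S' := by
        have h6 : 0 ≤ σ * (σ - 1) := mul_nonneg hσ.le (by linarith)
        have h7 : 0 ≤ σ * (1 - 2 * d) := mul_nonneg hσ.le (by linarith)
        linarith
      exact (mul_le_mul_of_nonneg_right h5 hκ.le).trans hS'le
  obtain ⟨hcβ, hsβ2⟩ := half_angle hρ W.one_add_cos_pos hβ
  have hn : 0 < ρ ^ 2 + σ ^ 2 := by positivity
  have hσρ : σ ≤ ρ := by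
    have h1 : ρ * d ≤ ρ * (κ / 24) := mul_le_mul_of_nonneg_left hd hρ.le
    have h2 : σ * κ ≤ ρ * κ := by linarith
    exact le_of_mul_le_mul_right h2 hκ
  have hcβ0 : 0 ≤ Real.cos β := by
    have h1 : 0 ≤ Real.cos β * (ρ ^ 2 + σ ^ 2) := by
      rw [hcβ]; exact sub_nonneg.2 (pow_le_pow_left₀ hσ.le hσρ 2)
    exact nonneg_of_mul_nonneg_left h1 hn
  have hsβκ : Real.sin β * κ ≤ 12 * d := by
    have h1 : ρ * Real.sin β ≤ 2 * σ := by
      rw [hβ]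
      have := mul_le_mul_of_nonneg_left (Real.cos_le_one β) hσ.le
      linarith
    have h2 : Real.sin β ≤ 2 * σ * d := by
      have h3 : Real.sin β * 1 ≤ Real.sin β * (ρ * d) := mul_le_mul_of_nonneg_left hρd hsβ.le
      have h4 := mul_le_mul_of_nonneg_right h1 hd0.le
      linarith
    have h3 := mul_le_mul_of_nonneg_right h2 hκ.le
    have h4 := mul_le_mul_of_nonneg_right hσle hd0.le
    linarith
  have hsβle : Real.sin β ≤ 12 * d / κ := by rw [le_div_iff₀ hκ]; exact hsβκ
  refine ⟨half_le_cos hcβ0 hsβ.le (hsβle.trans ?_), hsβle, hSS⟩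
  rw [div_le_iff₀ hκ]; linarith

/-- Two contact points separated by small turns differ mostly along the direction `e`. -/
theorem abs_cross_le_of_turn (V : View Q x e α q p s t)
    (W : View Q y (-(e * Complex.exp (((-β : ℝ) : ℂ) * Complex.I))) β p p' σ t')
    (hcα : 1 / 2 ≤ Real.cos α) (hcβ : 1 / 2 ≤ Real.cos β) {k : ℝ} (hα : Real.sin α ≤ k)
    (hβ : Real.sin β ≤ k) :
    0 ≤ dot e (p' - q) ∧ |cross e (p' - q)| ≤ 2 * k * dot e (p' - q) := by
  have hsα := V.sin_pos
  have hsβ := W.sin_pos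
  set X := dot e (p' - q) with hX
  set Y := cross e (p' - q) with hY
  have ha : Real.cos α * Y ≤ Real.sin α * X := by
    have h1 := V.left p' W.hp
    have h2 : cross (e * Complex.exp (α * Complex.I)) (q - x) = 0 := by
      have h4 : q - x = (s : ℂ) * (e * Complex.exp (α * Complex.I)) := by rw [V.q_eq]; ring
      rw [h4, cross_ofReal_mul_right, cross_self, mul_zero]
    rw [V.cross_e₁] at h1 h2
    rw [cross_sub_add_sub e p' q p, dot_sub_add_sub e p' q p, ← hX, ← hY] at h1
    linarith
  have hb : 0 ≤ Real.cos β * Y + Real.sin β * X := by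
    have h1 := W.cross_nonneg V.hq
    have h2 : q - p' = -(e * (⟨X, Y⟩ : ℂ)) := by
      rw [← eq_mul_coords V.norm_e (p' - q)]; ring
    have h3 : cross (-(e * Complex.exp (((-β : ℝ) : ℂ) * Complex.I))) (q - p')
        = cross (e * Complex.exp (((-β : ℝ) : ℂ) * Complex.I)) (e * (⟨X, Y⟩ : ℂ)) := by
      rw [h2, cross_neg_left, cross_comm, cross_neg_left, neg_neg, cross_comm, neg_neg]
    rw [h3, cross_unit_mul V.norm_e, exp_neg_eq_mk] at h1
    simp only [cross] at h1
    linarith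
  have hcα0 : 0 < Real.cos α := by linarith
  have hcβ00 : 0 < Real.cos β := by linarith
  have hXnn : 0 ≤ X := by
    have h1 := mul_le_mul_of_nonneg_left ha hcβ00.le
    have h2 := mul_nonneg hcα0.le hb
    have h3 : 0 < Real.cos β * Real.sin α + Real.cos α * Real.sin β := by positivity
    have h4 : 0 ≤ (Real.cos β * Real.sin α + Real.cos α * Real.sin β) * X := by linarith
    exact nonneg_of_mul_nonneg_right h4 h3
  refine ⟨hXnn, ?_⟩
  have h1 : Real.sin α * X ≤ k * X := mul_le_mul_of_nonneg_right hα hXnn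
  have h2 : Real.sin β * X ≤ k * X := mul_le_mul_of_nonneg_right hβ hXnn
  have h3 : 0 ≤ k * X := mul_nonneg (hsα.le.trans hα) hXnn
  rw [abs_le]
  constructor
  · by_contra hcon
    have h4 : Real.cos β * Y ≤ 1 / 2 * Y := mul_le_mul_of_nonpos_right hcβ (by linarith)
    linarith
  · by_contra hcon
    have h4 : 1 / 2 * Y ≤ Real.cos α * Y := mul_le_mul_of_nonneg_right hcα (by linarith)
    linarith

/-- The next view has left contact p and left direction -e, so the terms in p cancel exactly. What
remains would be the displacement, were the directions not turned by α and β; each turn costs at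
most its angle times d. -/
theorem dot_le_potential_sub (V : View Q x e α q p s t) (hQ : IsBody Q d κ)
    (W : View Q y (-(e * Complex.exp (((-β : ℝ) : ℂ) * Complex.I))) β p p' σ t') :
    dot e (p' - q) ≤ potential e α q p
      - potential (-(e * Complex.exp (((-β : ℝ) : ℂ) * Complex.I))) β p p' + d * (α + β) := by
  set e' := -(e * Complex.exp (((-β : ℝ) : ℂ) * Complex.I)) with he'
  have hback : e' * Complex.exp (β * Complex.I) = -e := turn_mul_exp e β
  have h1 : dot e (p' - q) = potential e α q p - potential e' β p p' + dot (e + e') p'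
      - dot (e - e * Complex.exp (α * Complex.I)) q := by
    rw [potential, potential, hback]
    simp only [dot, Complex.sub_re, Complex.sub_im, Complex.add_re, Complex.add_im, Complex.neg_re,
      Complex.neg_im]
    ring
  have h2 : |dot (e + e') p'| ≤ β * d := by
    refine (abs_dot_le _ _).trans ?_
    refine mul_le_mul ?_ (hQ.norm_le W.hp) (norm_nonneg _) W.α_pos.le
    have h4 : e + e' = e' * (1 - Complex.exp (β * Complex.I)) := by
      rw [mul_sub, mul_one, hback]; ring
    rw [h4, norm_mul, W.norm_e, one_mul]
    exact norm_one_sub_exp_le β W.α_pos.le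
  have h3 : |dot (e - e * Complex.exp (α * Complex.I)) q| ≤ α * d := by
    refine (abs_dot_le _ _).trans ?_
    refine mul_le_mul ?_ (hQ.norm_le V.hq) (norm_nonneg _) V.α_pos.le
    have h4 : e - e * Complex.exp (α * Complex.I) = e * (1 - Complex.exp (α * Complex.I)) := by ring
    rw [h4, norm_mul, V.norm_e, one_mul]
    exact norm_one_sub_exp_le α V.α_pos.le
  rw [abs_le] at h2 h3
  linarith

/-- One step of the billiard map: the angle stays small, and the change of the energy
`s t (1 + cos α)` is controlled by the change of the potential. -/
theorem step (V : View Q x e α q p s t) (hQ : IsBody Q d κ) (hd : d ≤ κ / 24)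
    (h₁ : 1 ≤ s * t * (1 + Real.cos α)) (h₃ : s * t * (1 + Real.cos α) ≤ 3)
    {y : ℂ} {ρ σ β t' : ℝ} {p' : ℂ} (hρ : 0 < ρ)
    (W : View Q y (-(e * Complex.exp (((-β : ℝ) : ℂ) * Complex.I))) β p p' σ t')
    (hα : ρ * Real.sin α = t * (1 + Real.cos α)) (hβ : ρ * Real.sin β = σ * (1 + Real.cos β)) :
    β ≤ 24 * d / κ ∧ |σ * t' * (1 + Real.cos β) - s * t * (1 + Real.cos α)| ≤
      144 / κ ^ 2 * (potential e α q p
        - potential (-(e * Complex.exp (((-β : ℝ) : ℂ) * Complex.I))) β p p' + d * (α + β)) := by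
  have hd0 := hQ.d_pos
  have hκ := hQ.κ_pos
  have hκ1 := hQ.κ_le
  obtain ⟨hs2, ht2, -, hcos, hsin, -⟩ := V.bounds hQ (by linarith) h₁ h₃
  have hH := V.height_ge hQ (by linarith) hcos hsin
  obtain ⟨hcβ, hsβ, hSS⟩ := V.step_bounds hQ hd h₁ h₃ hρ W hα hβ
  have hk : 2 * d ≤ 12 * d / κ := by
    rw [le_div_iff₀ hκ]
    have := mul_le_mul_of_nonneg_left hκ1 hd0.le
    linarith
  obtain ⟨-, hY⟩ := V.abs_cross_le_of_turn W hcos hcβ (hsin.trans hk) hsβ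
  have hpot := V.dot_le_potential_sub hQ W
  have hYH : cross e (p' - q) = t' * Real.sin β - s * Real.sin α := by
    rw [← V.cross_next W, ← V.cross_q]; linarith [cross_sub_add_sub e p' q p]
  refine ⟨?_, ?_⟩
  · have := angle_le_of_sin_le W.α_pos W.α_lt (by linarith) hsβ
    calc β ≤ 2 * (12 * d / κ) := this
      _ = 24 * d / κ := by ring
  refine le_trans ?_ (mul_le_mul_of_nonneg_left hpot (by positivity))
  generalize dot e (p' - q) = X at *
  generalize cross e (p' - q) = Y at *
  have hHpos : 0 < s * Real.sin α := mul_pos V.s_pos V.sin_pos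
  generalize s * Real.sin α = H at *
  generalize s * t * (1 + Real.cos α) = S at *
  generalize σ * t' * (1 + Real.cos β) = S' at *
  -- With S ≤ 3, H ≥ κd/2 and |Y| ≤ (24d/κ)X this gives the factor 3 · 24 · 2 / κ² = 144/κ².
  have h1 : (S' - S) * H = S * Y := by rw [hYH]; linear_combination hSS
  have h2 : |S' - S| * H = S * |Y| := by
    rw [← abs_of_pos hHpos, ← abs_mul, h1, abs_mul, abs_of_pos (show 0 < S by linarith)]
  have h3 : |S' - S| * (κ * d / 2) ≤ 3 * (2 * (12 * d / κ) * X) := by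
    refine (mul_le_mul_of_nonneg_left hH (abs_nonneg _)).trans ?_
    rw [h2]
    exact mul_le_mul h₃ hY (abs_nonneg _) (by norm_num)
  have h4 : 3 * (2 * (12 * d / κ) * X) = 144 / κ ^ 2 * X * (κ * d / 2) := by field_simp; ring
  rw [h4] at h3
  exact le_of_mul_le_mul_right h3 (by positivity)

end View

/-! ### Frames along an orbit and the drift of the energy. -/

/-- The data of a view. -/
structure Frame where
  e : ℂ
  α : ℝ
  q : ℂ
  p : ℂ
  s : ℝ
  t : ℝ

namespace Frame

/-- The frame `F` describes the view of `Q` from `x`. -/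
def Sees (F : Frame) (Q : Set ℂ) (x : ℂ) : Prop := View Q x F.e F.α F.q F.p F.s F.t

/-- The frame `F'` is the view from the image of the point with view `F`. -/
def Follows (F F' : Frame) : Prop :=
  F'.q = F.p ∧ F'.e = -(F.e * Complex.exp (((-F'.α : ℝ) : ℂ) * Complex.I)) ∧
    ∃ ρ : ℝ, 0 < ρ ∧ ρ * Real.sin F.α = F.t * (1 + Real.cos F.α) ∧
      ρ * Real.sin F'.α = F'.s * (1 + Real.cos F'.α)

/-- Half of `(s + t) ^ 2 - ‖q - p‖ ^ 2`; it changes only when the contact points change. -/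
noncomputable def energy (F : Frame) : ℝ := F.s * F.t * (1 + Real.cos F.α)

noncomputable def pot (F : Frame) : ℝ := View.potential F.e F.α F.q F.p

theorem Sees.step {F F' : Frame} {Q : Set ℂ} {x y : ℂ} {d κ : ℝ} (h : F.Sees Q x)
    (h' : F'.Sees Q y) (hF : F.Follows F') (hQ : IsBody Q d κ) (hd : d ≤ κ / 24)
    (h₁ : 1 ≤ F.energy) (h₃ : F.energy ≤ 3) :
    F'.α ≤ 24 * d / κ ∧
      |F'.energy - F.energy| ≤ 144 / κ ^ 2 * (F.pot - F'.pot + d * (F.α + F'.α)) := by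
  obtain ⟨hq, he, ρ, hρ, h1, h2⟩ := hF
  have h'' := h'
  rw [Sees, hq, he] at h''
  have := View.step h hQ hd h₁ h₃ hρ h'' h1 h2
  rw [energy, energy, pot, pot, hq, he]
  exact this

end Frame

theorem IsBody.exists_frames {Q : Set ℂ} {d κ : ℝ} (hQ : IsBody Q d κ) {x₀ : ℂ}
    (hx₀ : x₀ ∈ nonsingular Q) :
    ∃ F : ℕ → Frame, ∀ n, (F n).Sees Q ((T Q)^[n] x₀) ∧ (F n).Follows (F (n + 1)) := by
  obtain ⟨e, α, q, p, s, t, V⟩ := hQ.exists_view (hx₀ 0).1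
  have hstep : ∀ n (F : Frame), ∃ F' : Frame, F.Sees Q ((T Q)^[n] x₀) →
      F'.Sees Q ((T Q)^[n + 1] x₀) ∧ F.Follows F' := by
    intro n F
    by_cases hF : F.Sees Q ((T Q)^[n] x₀)
    · obtain ⟨ρ, σ, β, p', t', hρ, -, W, h1, h2⟩ := View.T_spec hF hQ (hx₀ n).1 (hx₀ n).2
      refine ⟨⟨-(F.e * Complex.exp (((-β : ℝ) : ℂ) * Complex.I)), β, F.p, p', σ, t'⟩, fun _ => ⟨?_, rfl, rfl, ρ, hρ, h1, h2⟩⟩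
      rw [Function.iterate_succ_apply']
      exact W
    -- A default value for frames that are not the view; it never occurs in the sequence built
    -- below.
    · exact ⟨F, fun h => absurd h hF⟩
  choose g hg using hstep
  set F : ℕ → Frame := fun n => Nat.rec ⟨e, α, q, p, s, t⟩ (fun n F => g n F) n with hFdef
  have hsees : ∀ n, (F n).Sees Q ((T Q)^[n] x₀) := by
    intro n
    induction n with
    | zero => exact V
    | succ n ih => exact (hg n (F n) ih).1
  exact ⟨F, fun n => ⟨hsees n, (hg n (F n) (hsees n)).2⟩⟩

/-- A sequence of frames along the orbit of a point of the unit circle. -/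
structure IsOrbit (Q : Set ℂ) (d κ : ℝ) (x₀ : ℂ) (F : ℕ → Frame) : Prop where
  body : IsBody Q d κ
  -- As 4000 > 3606, the drift in `energy_bound` stays below 1, which keeps the energy in [1, 3].
  small : d ≤ κ ^ 2 / 4000
  norm_x₀ : ‖x₀‖ = 1
  sees : ∀ n, (F n).Sees Q ((T Q)^[n] x₀)
  follows : ∀ n, (F n).Follows (F (n + 1))

/-- The total turn during the first `n` steps. -/
noncomputable def turn (F : ℕ → Frame) (n : ℕ) : ℝ := ∑ j ∈ Finset.range n, (F (j + 1)).α

theorem turn_succ (F : ℕ → Frame) (n : ℕ) : turn F (n + 1) = turn F n + (F (n + 1)).α :=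
  Finset.sum_range_succ _ _

namespace IsOrbit

variable {Q : Set ℂ} {d κ : ℝ} {x₀ : ℂ} {F : ℕ → Frame}

theorem small' (h : IsOrbit Q d κ x₀ F) : d ≤ κ / 4000 := by
  have h1 := h.body.κ_le
  have h2 := h.body.κ_pos
  have h3 := h.small
  nlinarith

theorem turn_mono (h : IsOrbit Q d κ x₀ F) : Monotone (turn F) :=
  monotone_nat_of_le_succ fun n => by
    rw [turn_succ]; linarith [(h.sees (n + 1)).α_pos]

theorem energy_zero (h : IsOrbit Q d κ x₀ F) : |(F 0).energy - 2| ≤ 6 * d := by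
  have h1 := View.norm_bound (h.sees 0) h.body
  rw [Function.iterate_zero, id, h.norm_x₀] at h1
  have h2 := h.small'
  have h3 := h.body.κ_le
  have h4 := h.body.d_pos
  rw [Frame.energy]
  norm_num at h1
  nlinarith

/-- A bootstrap: the summed bound up to n keeps the energy in [1, 3], which permits the step to n +
1. The threshold 10 exceeds 3π. -/
theorem energy_bound (h : IsOrbit Q d κ x₀ F) : ∀ n, turn F n ≤ 10 →
    |(F n).energy - 2| ≤ 3606 / κ ^ 2 * d := by
  have hd := h.small'
  have hκ1 := h.body.κ_le
  have hκ := h.body.κ_pos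
  have hd0 := h.body.d_pos
  have hE0 := h.energy_zero
  have hκ2 : 1 ≤ 1 / κ ^ 2 := by
    rw [le_div_iff₀ (by positivity)]; nlinarith
  have hsmall : 3606 / κ ^ 2 * d ≤ 1 := by
    have h1 := h.small
    rw [div_mul_eq_mul_div, div_le_one (by positivity)]
    linarith
  have hα0 : (F 0).α ≤ 1 := by
    obtain ⟨-, -, -, -, -, h1⟩ := View.bounds (h.sees 0) h.body (by linarith)
      (by have := (abs_le.1 hE0).1; rw [Frame.energy] at this; linarith)
      (by have := (abs_le.1 hE0).2; rw [Frame.energy] at this; linarith)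
    linarith
  have hW : ∀ n, |(F n).pot| ≤ 2 * d := fun n => View.abs_potential_le (h.sees n) h.body
  -- from the telescoped bound to the final one
  have hfin : ∀ n, turn F n ≤ 10 → |(F n).energy - (F 0).energy| ≤
      144 / κ ^ 2 * ((F 0).pot - (F n).pot + d * ((F 0).α + 2 * turn F n - (F n).α)) →
      |(F n).energy - 2| ≤ 3606 / κ ^ 2 * d := by
    intro n hn hb
    have h0 := abs_le.1 (hW 0)
    have h1 := abs_le.1 (hW n)
    have hαn := (h.sees n).α_pos
    have h2 : d * ((F 0).α + 2 * turn F n - (F n).α) ≤ d * 21 :=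
      mul_le_mul_of_nonneg_left (by linarith) hd0.le
    have h3 : 144 / κ ^ 2 * ((F 0).pot - (F n).pot + d * ((F 0).α + 2 * turn F n - (F n).α))
        ≤ 144 / κ ^ 2 * (25 * d) := mul_le_mul_of_nonneg_left (by linarith) (by positivity)
    have h4 : |(F n).energy - 2| ≤ |(F n).energy - (F 0).energy| + |(F 0).energy - 2| :=
      abs_sub_le _ _ _
    have h5 : 6 * d ≤ 6 / κ ^ 2 * d := by
      apply mul_le_mul_of_nonneg_right _ hd0.le
      rw [le_div_iff₀ (by positivity)]
      nlinarith
    -- Here 25 = 2 + 2 + 21: two values of the potential, and 21 ≥ α₀ + 2 · turn. The last 6 is the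
    -- initial deviation of the energy from 2.
    have h6 : 3606 / κ ^ 2 * d = 144 / κ ^ 2 * (25 * d) + 6 / κ ^ 2 * d := by ring
    linarith
  have main : ∀ n, turn F n ≤ 10 → |(F n).energy - (F 0).energy| ≤
      144 / κ ^ 2 * ((F 0).pot - (F n).pot + d * ((F 0).α + 2 * turn F n - (F n).α)) := by
    intro n
    induction n with
    | zero => intro _; simp [turn]
    | succ n ih =>
      intro hn
      have hαn := (h.sees (n + 1)).α_pos
      rw [turn_succ] at hn
      have hn' : turn F n ≤ 10 := by linarith
      have hE := abs_le.1 (hfin n hn' (ih hn'))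
      obtain ⟨-, h1⟩ := (h.sees n).step (h.sees (n + 1)) (h.follows n) h.body (by linarith)
        (by linarith) (by linarith)
      have h2 := abs_sub_le (F (n + 1)).energy (F n).energy (F 0).energy
      have h3 := ih hn'
      rw [turn_succ]
      calc _ ≤ _ := h2
        _ ≤ _ := add_le_add h1 h3
        _ = _ := by ring
  exact fun n hn => hfin n hn (main n hn)

theorem energy_mem (h : IsOrbit Q d κ x₀ F) {n : ℕ} (hn : turn F n ≤ 10) :
    1 ≤ (F n).energy ∧ (F n).energy ≤ 3 := by
  have h1 := abs_le.1 (h.energy_bound n hn)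
  have hκ := h.body.κ_pos
  have hsmall : 3606 / κ ^ 2 * d ≤ 1 := by
    have h1 := h.small
    have := h.body.d_pos
    rw [div_mul_eq_mul_div, div_le_one (by positivity)]
    linarith
  constructor <;> linarith

theorem α_succ_le (h : IsOrbit Q d κ x₀ F) {n : ℕ} (hn : turn F n ≤ 10) :
    (F (n + 1)).α ≤ 1 / 100 := by
  have hκ := h.body.κ_pos
  have hd := h.small'
  have hd0 := h.body.d_pos
  obtain ⟨h1, h3⟩ := h.energy_mem hn
  obtain ⟨h2, -⟩ := (h.sees n).step (h.sees (n + 1)) (h.follows n) h.body (by linarith) h1 h3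
  refine h2.trans ?_
  rw [div_le_iff₀ hκ]; linarith

theorem norm_bound (h : IsOrbit Q d κ x₀ F) {n : ℕ} (hn : turn F n ≤ 10) :
    |‖(T Q)^[n] x₀‖ - 1| ≤ d * (1810 / κ ^ 2) := by
  have hd := h.small'
  have hκ1 := h.body.κ_le
  have hκ := h.body.κ_pos
  have hd0 := h.body.d_pos
  obtain ⟨h1, h3⟩ := h.energy_mem hn
  obtain ⟨-, -, ht, -⟩ := View.bounds (h.sees n) h.body (by linarith) h1 h3
  have hE := abs_le.1 (h.energy_bound n hn)
  have hN := abs_le.1 (View.norm_bound (h.sees n) h.body)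
  set x := (T Q)^[n] x₀
  have hr0 := norm_nonneg x
  have hr : ‖x‖ ≤ 3 := by
    have h4 := View.norm_p_sub (h.sees n)
    have h5 := h.body.norm_le (h.sees n).hp
    have h6 := norm_sub_norm_le x (F n).p
    rw [norm_sub_rev, h4] at h6
    linarith
  change -(4 * ‖x‖ * d + 2 * d ^ 2) ≤ (F n).energy - 2 * ‖x‖ ^ 2 ∧
    (F n).energy - 2 * ‖x‖ ^ 2 ≤ 4 * ‖x‖ * d + 2 * d ^ 2 at hN
  have h7 : 4 * ‖x‖ * d + 2 * d ^ 2 ≤ 14 / κ ^ 2 * d := by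
    have h8 : ‖x‖ * d ≤ 3 * d := mul_le_mul_of_nonneg_right hr hd0.le
    have h9 : 14 * d ≤ 14 / κ ^ 2 * d := by
      apply mul_le_mul_of_nonneg_right _ hd0.le
      rw [le_div_iff₀ (by positivity)]
      nlinarith
    nlinarith
  have h8 : |‖x‖ ^ 2 - 1| ≤ d * (1810 / κ ^ 2) := by
    -- Energy drift plus the error in S ≈ 2‖x‖², halved.
    have h9 : 3606 / κ ^ 2 * d + 14 / κ ^ 2 * d = 2 * (d * (1810 / κ ^ 2)) := by ring
    rw [abs_le]
    constructor <;> linarith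
  refine le_trans ?_ h8
  have h9 : ‖x‖ ^ 2 - 1 = (‖x‖ - 1) * (‖x‖ + 1) := by ring
  rw [h9, abs_mul]
  refine le_mul_of_one_le_right (abs_nonneg _) ?_
  rw [abs_of_nonneg (by linarith)]; linarith

/-! ### Clockwise rotation of the orbit and its wrap around. -/

theorem e_eq (h : IsOrbit Q d κ x₀ F) (n : ℕ) :
    (F n).e = (-1) ^ n * ((F 0).e * Complex.exp (((-turn F n : ℝ) : ℂ) * Complex.I)) := by
  induction n with
  | zero => simp [turn]
  | succ n ih =>
    rw [(h.follows n).2.1, ih, turn_succ, pow_succ]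
    have : Complex.exp (((-(turn F n + (F (n + 1)).α) : ℝ) : ℂ) * Complex.I)
        = Complex.exp (((-turn F n : ℝ) : ℂ) * Complex.I)
          * Complex.exp (((-(F (n + 1)).α : ℝ) : ℂ) * Complex.I) := by
      rw [← Complex.exp_add]; congr 1; push_cast; ring
    rw [this]; ring

/-- The position of the points of even index relative to `x₀` is read off the total turn. -/
theorem cross_even (h : IsOrbit Q d κ x₀ F) {k : ℕ} (hk : turn F (2 * k) ≤ 10) :
    (Real.sin (turn F (2 * k)) ≤ -(1 / 2) → 0 < cross x₀ ((T Q)^[2 * k] x₀)) ∧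
      (1 / 2 ≤ Real.sin (turn F (2 * k)) → cross x₀ ((T Q)^[2 * k] x₀) < 0) := by
  have hd := h.small'
  have hκ1 := h.body.κ_le
  have hd0 := h.body.d_pos
  obtain ⟨h1, h3⟩ := h.energy_mem hk
  obtain ⟨h1', h3'⟩ := h.energy_mem (n := 0) (by simp [turn])
  obtain ⟨-, ht, ht2, -⟩ := View.bounds (h.sees (2 * k)) h.body (by linarith) h1 h3
  obtain ⟨-, ht', ht2', -⟩ := View.bounds (h.sees 0) h.body (by linarith) h1' h3'
  have hp := h.body.norm_le (h.sees (2 * k)).hp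
  have hp' := h.body.norm_le (h.sees 0).hp
  have hx : (T Q)^[2 * k] x₀ = (F (2 * k)).p - ((F (2 * k)).t : ℂ) * (F (2 * k)).e := by
    have := (h.sees (2 * k)).p_eq
    linear_combination -this
  have hx' : x₀ = (F 0).p - ((F 0).t : ℂ) * (F 0).e := by
    have := (h.sees 0).p_eq
    rw [Function.iterate_zero, id] at this
    linear_combination -this
  have hee : cross (F 0).e (F (2 * k)).e = -Real.sin (turn F (2 * k)) := by
    have h5 := cross_unit_mul (h.sees 0).norm_e 1
      (Complex.exp (((-turn F (2 * k) : ℝ) : ℂ) * Complex.I))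
    rw [mul_one] at h5
    rw [h.e_eq (2 * k), pow_mul]
    norm_num only [one_pow, one_mul]
    rw [h5, exp_neg_eq_mk]; simp [cross]
  have hn := (h.sees (2 * k)).norm_e
  have hn' := (h.sees 0).norm_e
  have a1 := (abs_cross_le (F 0).p (F (2 * k)).p).trans
    (mul_le_mul hp' hp (norm_nonneg _) hd0.le)
  have a2 := abs_cross_le (F 0).p (F (2 * k)).e
  have a3 := abs_cross_le (F 0).e (F (2 * k)).p
  rw [hn, mul_one] at a2
  rw [hn', one_mul] at a3
  have b1 := abs_le.1 a1
  have b2 := abs_le.1 (a2.trans hp')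
  have b3 := abs_le.1 (a3.trans hp)
  -- The last term has size at least 1/8 when |sin| ≥ 1/2; the other three add up to at most 5d.
  have hexp : cross x₀ ((T Q)^[2 * k] x₀) = cross (F 0).p (F (2 * k)).p
      - (F (2 * k)).t * cross (F 0).p (F (2 * k)).e - (F 0).t * cross (F 0).e (F (2 * k)).p
      - (F 0).t * (F (2 * k)).t * Real.sin (turn F (2 * k)) := by
    rw [hx]
    nth_rewrite 1 [hx']
    have h7 : ∀ a b c e : ℂ, cross (a - b) (c - e)
        = cross a c - cross a e - cross b c + cross b e := by
      intro a b c e; simp only [cross, Complex.sub_re, Complex.sub_im]; ring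
    rw [h7, cross_ofReal_mul_right, cross_ofReal_mul_left, cross_ofReal_mul_left,
      cross_ofReal_mul_right, hee]
    ring
  generalize (F 0).t = τ' at *
  generalize (F (2 * k)).t = τ at *
  generalize cross (F 0).p (F (2 * k)).e = A at *
  generalize cross (F 0).e (F (2 * k)).p = B at *
  have c1 : |τ * A| ≤ 2 * d := by
    rw [abs_mul, abs_of_pos (by linarith)]
    exact mul_le_mul ht2 (abs_le.2 b2) (abs_nonneg _) (by norm_num)
  have c2 : |τ' * B| ≤ 2 * d := by
    rw [abs_mul, abs_of_pos (by linarith)]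
    exact mul_le_mul ht2' (abs_le.2 b3) (abs_nonneg _) (by norm_num)
  have c1' := abs_le.1 c1
  have c2' := abs_le.1 c2
  have hdd : d * d ≤ d := by nlinarith
  have htt : 1 / 4 ≤ τ' * τ := by nlinarith
  rw [hexp]
  constructor
  · intro hs
    nlinarith
  · intro hs
    nlinarith

end IsOrbit

theorem relArg_pos_iff (x z : ℂ) : 0 < relArg x z ↔ 0 < cross x z := by
  rw [relArg, neg_pos, Complex.arg_neg_iff]
  have h : (x / z).im = -cross x z / Complex.normSq z := by
    rw [Complex.div_im, cross]; ring
  rw [h]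
  rcases eq_or_ne z 0 with rfl | hz
  · simp [cross]
  · rw [div_neg_iff]
    have := Complex.normSq_pos.2 hz
    constructor
    · rintro (⟨-, h2⟩ | ⟨h1, -⟩) <;> linarith
    · intro h1; right; exact ⟨by linarith, this⟩

theorem half_le_sin {y : ℝ} (h₁ : Real.pi / 6 ≤ y) (h₂ : y ≤ 5 * Real.pi / 6) :
    1 / 2 ≤ Real.sin y := by
  rw [← Real.cos_pi_div_two_sub, ← Real.cos_abs, ← Real.cos_pi_div_three]
  apply Real.cos_le_cos_of_nonneg_of_le_pi (abs_nonneg _) (by linarith [Real.pi_pos])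
  rw [abs_le]
  constructor <;> linarith

/-- Before the orbit wraps around, the total turn is at most `3π`. -/
theorem IsOrbit.turn_le {Q : Set ℂ} {d κ : ℝ} {x₀ : ℂ} {F : ℕ → Frame} (h : IsOrbit Q d κ x₀ F)
    {n : ℕ} (hn : ∀ N : ℕ, IsLeast {M | WrapsAt Q x₀ M} N → n ≤ 2 * N) :
    turn F n ≤ 3 * Real.pi := by
  by_contra hcon
  rw [not_le] at hcon
  have hπ := Real.pi_gt_three
  have hπ' := Real.pi_lt_d2
  have hmono := h.turn_mono
  have h0 : turn F 0 = 0 := by simp [turn]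
  classical
  have hex : ∃ m, 3 * Real.pi < turn F m := ⟨n, hcon⟩
  obtain ⟨m, hm⟩ : ∃ m, Nat.find hex = m + 1 := by
    refine Nat.exists_eq_succ_of_ne_zero (fun h1 => ?_)
    have := Nat.find_spec hex
    rw [h1, h0] at this
    linarith
  have hm1 : 3 * Real.pi < turn F (m + 1) := hm ▸ Nat.find_spec hex
  have hm2 : turn F m ≤ 3 * Real.pi :=
    not_lt.1 (Nat.find_min hex (by rw [hm]; exact Nat.lt_succ_self m))
  have hstep : ∀ j ≤ m, (F (j + 1)).α ≤ 1 / 100 := fun j hj =>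
    h.α_succ_le (by linarith [hmono hj])
  have hcross : ∀ c, 0 < c → c ≤ 3 * Real.pi - 1 / 10 →
      ∃ k, c ≤ turn F (2 * k) ∧ turn F (2 * k) ≤ c + 1 / 50 := by
    intro c hc hc'
    -- The index m rounded up to an even number; its turn is above 3π - 1/100.
    have hexk : c ≤ turn F (2 * ((m + 1) / 2)) := by
      have h1 : m ≤ 2 * ((m + 1) / 2) := by omega
      have h2 := hmono h1
      have h3 := hstep m le_rfl
      rw [turn_succ] at hm1
      linarith
    have hex2 : ∃ k, c ≤ turn F (2 * k) := ⟨_, hexk⟩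
    refine ⟨Nat.find hex2, Nat.find_spec hex2, ?_⟩
    have hle : Nat.find hex2 ≤ (m + 1) / 2 := Nat.find_min' hex2 hexk
    obtain ⟨k, hk⟩ : ∃ k, Nat.find hex2 = k + 1 := by
      refine Nat.exists_eq_succ_of_ne_zero (fun h1 => ?_)
      have := Nat.find_spec hex2
      rw [h1, mul_zero, h0] at this
      linarith
    have hlt := not_le.1 (Nat.find_min hex2 (m := k) (by omega))
    rw [hk, show 2 * (k + 1) = 2 * k + 1 + 1 by ring, turn_succ, turn_succ]
    have h1 := hstep (2 * k) (by omega)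
    have h2 := hstep (2 * k + 1) (by omega)
    linarith
  -- From 7π/6 on the sine stays at most -1/2, and from 13π/6 on at least 1/2, for longer than the
  -- overshoot 1/50 of two steps.
  obtain ⟨k₀, ha₀, hb₀⟩ := hcross (7 * Real.pi / 6) (by linarith) (by linarith)
  obtain ⟨k₁, ha₁, hb₁⟩ := hcross (13 * Real.pi / 6) (by linarith) (by linarith)
  have hk : k₀ < k₁ := by
    by_contra hcon2
    have := hmono (show 2 * k₁ ≤ 2 * k₀ by omega)
    linarith
  have hg₀ : 0 < cross x₀ ((T Q)^[2 * k₀] x₀) := by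
    refine (h.cross_even (by linarith)).1 ?_
    have h1 := half_le_sin (y := turn F (2 * k₀) - Real.pi) (by linarith) (by linarith)
    rw [Real.sin_sub_pi] at h1
    linarith
  have hg₁ : cross x₀ ((T Q)^[2 * k₁] x₀) < 0 := by
    refine (h.cross_even (by linarith)).2 ?_
    have h1 := half_le_sin (y := turn F (2 * k₁) - 2 * Real.pi) (by linarith) (by linarith)
    rwa [Real.sin_sub_two_pi] at h1
  -- The first sign change after k₀ is a wrap, and it occurs no later than k₁. Then n ≤ 2k₁ bounds
  -- the turn by 13π/6 + 1/50 < 3π.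
  have hex3 : ∃ M, k₀ < M ∧ cross x₀ ((T Q)^[2 * M] x₀) ≤ 0 := ⟨k₁, hk, hg₁.le⟩
  set M := Nat.find hex3 with hM
  obtain ⟨hM1, hM2⟩ := Nat.find_spec hex3
  have hMk : M ≤ k₁ := Nat.find_min' hex3 ⟨hk, hg₁.le⟩
  have hMprev : 0 < cross x₀ ((T Q)^[2 * (M - 1)] x₀) := by
    rcases eq_or_ne (M - 1) k₀ with h1 | h1
    · rw [h1]; exact hg₀
    · have h2 := Nat.find_min hex3 (m := M - 1) (by omega)
      by_contra h3
      exact h2 ⟨by omega, not_lt.1 h3⟩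
  have hwrap : WrapsAt Q x₀ M := by
    refine ⟨by omega, (relArg_pos_iff _ _).2 hMprev, ?_⟩
    rw [← not_lt, relArg_pos_iff, not_lt]
    exact hM2
  have hex4 : ∃ M, WrapsAt Q x₀ M := ⟨M, hwrap⟩
  have h5 := hn (Nat.find hex4) ⟨Nat.find_spec hex4, fun a ha => Nat.find_min' hex4 ha⟩
  have h6 : Nat.find hex4 ≤ M := Nat.find_min' hex4 hwrap
  have h7 := hmono (show n ≤ 2 * k₁ by omega)
  linarith

/-! ### The circle centre and the dual of the symmetrization. -/

namespace View

variable {Q : Set ℂ} {d κ : ℝ} {x e : ℂ} {α : ℝ} {q p : ℂ} {s t : ℝ}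

/-- The contact point p is within d of the origin, so looking from x at p is nearly looking at the
origin. -/
theorem norm_dir_add_le (V : View Q x e α q p s t) (hQ : IsBody Q d κ) (ht : 1 / 2 ≤ t) {r : ℝ} {w : ℂ}
    (hr : 0 < r) (hw : ‖w‖ = 1) (hx : x = (r : ℂ) * w) : ‖e + w‖ ≤ 4 * d := by
  have hp := hQ.norm_le V.hp
  have h1 : (t : ℂ) * (e + w) = p + ((t - r : ℝ) : ℂ) * w := by
    rw [V.p_eq, hx]; push_cast; ring
  have h2 : |t - r| ≤ d := by
    have h3 : ‖x‖ = r := by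
      rw [hx, norm_mul, hw, Complex.norm_real, Real.norm_eq_abs, abs_of_pos hr, mul_one]
    have h4 := abs_norm_sub_norm_le (p - x) (-x)
    rw [V.norm_p_sub, norm_neg, h3] at h4
    have h5 : p - x - -x = p := by ring
    rw [h5] at h4
    exact h4.trans hp
  have h3 : t * ‖e + w‖ ≤ 2 * d := by
    have h4 := norm_add_le p (((t - r : ℝ) : ℂ) * w)
    rw [← h1, norm_mul, norm_mul, hw, Complex.norm_real, Complex.norm_real, Real.norm_eq_abs,
      Real.norm_eq_abs, abs_of_pos V.t_pos, mul_one] at h4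
    linarith
  have h4 := mul_le_mul_of_nonneg_right ht (norm_nonneg (e + w))
  linarith

/-- The width of the body across the line of sight is nearly the height of the contact point. -/
theorem abs_width_sub_height_le (V : View Q x e α q p s t) (hQ : IsBody Q d κ)
    (hc : 1 / 2 ≤ Real.cos α) (hs : Real.sin α ≤ 2 * d) {θ : ℝ}
    (hw : ‖e + Complex.exp (θ * Complex.I)‖ ≤ 4 * d) :
    |2 * supportFn (symmetrization Q) (θ + Real.pi / 2) - s * Real.sin α| ≤ 8 * d ^ 2 := by
  have hd0 := hQ.d_pos
  set w := Complex.exp (θ * Complex.I) with hwdef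
  have hcr : ∀ z : ℂ, z.re * Real.cos (θ + Real.pi / 2) + z.im * Real.sin (θ + Real.pi / 2)
      = cross w z := by
    intro z
    rw [Real.cos_add_pi_div_two, Real.sin_add_pi_div_two, hwdef, exp_eq_mk]
    simp only [cross]; ring
  have hhalf : ∀ z : ℂ, cross w ((1 / 2 : ℝ) • z) = 1 / 2 * cross w z := by
    intro z
    rw [Complex.real_smul, cross_ofReal_mul_right]
  have hdiff : ∀ a ∈ Q, ∀ b ∈ Q, |cross w (a - b) - cross e (b - a)| ≤ 4 * d ^ 2 := by
    intro a ha b hb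
    have h1 : cross w (a - b) - cross e (b - a) = cross (e + w) (a - b) := by
      simp only [cross, Complex.sub_re, Complex.sub_im, Complex.add_re, Complex.add_im]; ring
    rw [h1]
    refine (abs_cross_le _ _).trans ?_
    calc _ ≤ 4 * d * d := mul_le_mul hw (hQ.norm_sub_le a ha b hb) (norm_nonneg _) (by positivity)
      _ = 4 * d ^ 2 := by ring
  have hup : ∀ v ∈ (fun z : ℂ => z.re * Real.cos (θ + Real.pi / 2)
      + z.im * Real.sin (θ + Real.pi / 2)) '' symmetrization Q,
      v ≤ (s * Real.sin α + 8 * d ^ 2) / 2 := by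
    rintro v ⟨z, hz, rfl⟩
    obtain ⟨y, ⟨a, ha, b, hb, rfl⟩, rfl⟩ := hz
    simp only [hcr]
    rw [hhalf]
    have h1 := (abs_le.1 (hdiff a ha b hb)).2
    have h2 := V.cross_sub_q_le hQ hc hs hb
    have h3 := V.cross_nonneg ha
    have h4 := V.cross_q
    have h5 : cross e (b - a) = cross e (b - q) + cross e (q - p) - cross e (a - p) := by
      simp only [cross, Complex.sub_re, Complex.sub_im]; ring
    linarith
  have hlow : (s * Real.sin α - 4 * d ^ 2) / 2 ≤ cross w ((1 / 2 : ℝ) • (p - q)) := by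
    rw [hhalf]
    have h1 := (abs_le.1 (hdiff p V.hp q V.hq)).1
    rw [V.cross_q] at h1
    linarith
  have hmem : cross w ((1 / 2 : ℝ) • (p - q)) ∈ (fun z : ℂ => z.re * Real.cos (θ + Real.pi / 2)
      + z.im * Real.sin (θ + Real.pi / 2)) '' symmetrization Q :=
    ⟨(1 / 2 : ℝ) • (p - q), Set.smul_mem_smul_set (Set.sub_mem_sub V.hp V.hq), hcr _⟩
  have h1 := csSup_le ⟨_, hmem⟩ hup
  have h2 := le_csSup ⟨_, hup⟩ hmem
  have hdd := sq_nonneg d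
  rw [supportFn, abs_le]
  constructor <;> linarith

theorem norm_chi_sub_le (V : View Q x e α q p s t) (hQ : IsBody Q d κ) (hx : x ∉ Q)
    (hcl : ¬ OnClockwiseExtension Q x) (hd : d ≤ κ / 32)
    (h₁ : 1 ≤ s * t * (1 + Real.cos α)) (h₃ : s * t * (1 + Real.cos α) ≤ 3) {A : ℝ}
    (hA : |s * t * (1 + Real.cos α) - 2| ≤ A * d) {r θ : ℝ} (hr : 0 < r)
    (hxr : x = (r : ℂ) * Complex.exp (θ * Complex.I)) :
    ‖chi Q x - (dualRadial (symmetrization Q) θ : ℂ) * (⟨-Real.sin θ, Real.cos θ⟩ : ℂ)‖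
      ≤ d + 24 / κ + (2 * A / κ + 128 / κ ^ 2) := by
  have hd0 := hQ.d_pos
  have hκ := hQ.κ_pos
  have hκ1 := hQ.κ_le
  obtain ⟨hs2, ht2, -, hcos, hsin, -⟩ := V.bounds hQ (by linarith) h₁ h₃
  have hH := V.height_ge hQ (by linarith) hcos hsin
  obtain ⟨ρ, hρ, hchi⟩ := V.chi_spec hQ.convex hx hcl
  have hw : ‖e + Complex.exp (θ * Complex.I)‖ ≤ 4 * d :=
    V.norm_dir_add_le hQ ht2 hr (norm_exp_mul_I' θ) hxr
  have hwidth := V.abs_width_sub_height_le hQ hcos hsin hw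
  have hHpos : 0 < s * Real.sin α := mul_pos V.s_pos V.sin_pos
  have hρS : ρ * (s * Real.sin α) = s * t * (1 + Real.cos α) := by linear_combination s * hρ
  set w := Complex.exp (θ * Complex.I) with hwdef
  have hrot : (⟨-Real.sin θ, Real.cos θ⟩ : ℂ) = w * Complex.I := by
    rw [hwdef, exp_eq_mk]
    apply Complex.ext <;> simp
  have hΓ : dualRadial (symmetrization Q) θ
      = 2 / (2 * supportFn (symmetrization Q) (θ + Real.pi / 2)) := by
    rw [dualRadial]; field_simp
  rw [hΓ, hrot, hchi]
  generalize 2 * supportFn (symmetrization Q) (θ + Real.pi / 2) = v at *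
  generalize s * Real.sin α = H at *
  generalize s * t * (1 + Real.cos α) = S at *
  have hρpos : 0 < ρ := pos_of_mul_pos_left (show 0 < ρ * H by rw [hρS]; linarith) hHpos.le
  have hκd : 0 < κ * d := mul_pos hκ hd0
  have hv : κ * d / 4 ≤ v := by
    have h1 := (abs_le.1 hwidth).1
    nlinarith
  have hvpos : 0 < v := by linarith
  have hρle : ρ * (κ * d) ≤ 6 := by
    have := mul_le_mul_of_nonneg_left hH hρpos.le
    linarith
  have hn1 : ρ * ‖e + w‖ ≤ 24 / κ := by
    rw [le_div_iff₀ hκ]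
    have h1 := mul_le_mul_of_nonneg_left hw (mul_pos hρpos hκ).le
    linarith
  have hρeq : ρ = S / H := by rw [← hρS]; field_simp
  have hn2 : |ρ - 2 / v| ≤ 2 * A / κ + 128 / κ ^ 2 := by
    -- The numerators are O(d) and O(d²), while H and v are at least of order d, so both quotients
    -- are bounded.
    have h1 : ρ - 2 / v = (S - 2) / H + 2 * (v - H) / (H * v) := by
      rw [hρeq]; field_simp; ring
    rw [h1]
    refine (abs_add_le _ _).trans (add_le_add ?_ ?_)
    · rw [abs_div, abs_of_pos hHpos, div_le_div_iff₀ hHpos hκ]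
      have hA0 : 0 ≤ A := by
        have := (abs_nonneg _).trans hA
        exact nonneg_of_mul_nonneg_left this hd0
      have h2 := mul_le_mul_of_nonneg_right hA hκ.le
      have h3 := mul_le_mul_of_nonneg_left hH (show 0 ≤ 2 * A by linarith)
      linarith
    · rw [abs_div, abs_mul, abs_of_pos (mul_pos hHpos hvpos), abs_of_pos (two_pos),
        div_le_div_iff₀ (mul_pos hHpos hvpos) (by positivity)]
      have h2 : κ * d / 2 * (κ * d / 4) ≤ H * v :=
        mul_le_mul hH hv (by positivity) hHpos.le
      have h3 := mul_le_mul_of_nonneg_right hwidth (show 0 ≤ 2 * κ ^ 2 by positivity)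
      nlinarith
  have hsplit : p - (ρ : ℂ) * (e * Complex.I) - ((2 / v : ℝ) : ℂ) * (w * Complex.I)
      = p - (ρ : ℂ) * ((e + w) * Complex.I) + ((ρ - 2 / v : ℝ) : ℂ) * (w * Complex.I) := by
    push_cast; ring
  rw [hsplit]
  refine (norm_add_le _ _).trans (add_le_add ((norm_sub_le _ _).trans
    (add_le_add (hQ.norm_le V.hp) ?_)) ?_)
  · rw [norm_mul, norm_mul, Complex.norm_I, mul_one, Complex.norm_real, Real.norm_eq_abs,
      abs_of_pos hρpos]
    exact hn1
  · rw [norm_mul, norm_mul, Complex.norm_I, mul_one, Complex.norm_real, Real.norm_eq_abs,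
      norm_exp_mul_I', mul_one]
    exact hn2

end View

/-! ### From polygons to bodies, and the theorem. -/

/-- The multiples of a polygon of diameter `1` around the origin are bodies. -/
theorem IsConvexPolygon.exists_isBody_smul {K : Set ℂ} (hK : IsConvexPolygon K)
    (hdiam : Metric.diam K = 1) (h0 : (0 : ℂ) ∈ interior K) :
    ∃ κ : ℝ, 0 < κ ∧ κ ≤ 1 ∧ ∀ d : ℝ, 0 < d → IsBody (d • K) d κ := by
  obtain ⟨V, rfl, -⟩ := hK
  set K := convexHull ℝ (V : Set ℂ)
  have hconv : Convex ℝ K := convex_convexHull ℝ _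
  have hcomp : IsCompact K := V.finite_toSet.isCompact_convexHull ℝ
  rw [mem_interior_iff_mem_nhds, Metric.mem_nhds_iff] at h0
  obtain ⟨r, hr, hball⟩ := h0
  -- Half the radius, since the ball inside K is open while `IsBody` asks for a closed disc.
  refine ⟨min (r / 2) 1, by positivity, min_le_right _ _, fun d hd => ?_⟩
  refine ⟨hconv.smul d, hcomp.smul d, hd, by positivity, min_le_right _ _, ?_, ?_⟩
  · rintro _ ⟨z, hz, rfl⟩ _ ⟨w, hw, rfl⟩
    have h1 := Metric.dist_le_diam_of_mem hcomp.isBounded hz hw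
    rw [hdiam, dist_eq_norm] at h1
    simp only
    rw [← smul_sub, norm_smul, Real.norm_eq_abs, abs_of_pos hd]
    exact mul_le_of_le_one_right hd.le h1
  · intro z hz
    refine ⟨d⁻¹ • z, hball ?_, smul_inv_smul₀ hd.ne' z⟩
    rw [mem_ball_zero_iff, norm_smul, norm_inv, Real.norm_eq_abs, abs_of_pos hd,
      inv_mul_lt_iff₀ hd]
    have h1 := mul_le_mul_of_nonneg_right (min_le_left (r / 2) 1) hd.le
    have := mul_pos hd hr
    linarith

end OuterLength

theorem theorem4p2 (K : Set ℂ) (hK : OuterLength.IsConvexPolygon K) (hdiam : Metric.diam K = 1)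
    (h0 : (0 : ℂ) ∈ interior K) :
    ∃ C₁ C₂ : ℝ, 0 < C₁ ∧ C₁ ≤ C₂ ∧
      (∀ d : ℝ, 0 < d → d < 1 / C₂ →
        ∀ x₀ ∈ OuterLength.nonsingular (d • K), ‖x₀‖ = 1 →
          ∀ x ∈ OuterLength.onceAround (d • K) x₀, |‖x‖ - 1| ≤ d * C₁) ∧
      ∃ ε C₃ : ℝ, 0 < ε ∧ 0 < C₃ ∧
        ∀ d : ℝ, 0 < d → d < 1 / C₂ → d ≤ ε →
          ∀ x₀ ∈ OuterLength.nonsingular (d • K), ‖x₀‖ = 1 →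
            ∀ r θ : ℝ, 0 < r →
              (r : ℂ) * Complex.exp (θ * Complex.I) ∈ OuterLength.onceAround (d • K) x₀ →
              ‖OuterLength.chi (d • K) ((r : ℂ) * Complex.exp (θ * Complex.I)) -
                  (OuterLength.dualRadial (OuterLength.symmetrization (d • K)) θ : ℂ) *
                    (⟨-Real.sin θ, Real.cos θ⟩ : ℂ)‖ ≤ C₃ := by
  obtain ⟨κ, hκ, hκ1, hbody⟩ := hK.exists_isBody_smul hdiam h0
  have horbit : ∀ d : ℝ, 0 < d → d < 1 / (4000 / κ ^ 2) →
      ∀ x₀ ∈ OuterLength.nonsingular (d • K), ‖x₀‖ = 1 →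
        ∀ x ∈ OuterLength.onceAround (d • K) x₀, ∃ F n, OuterLength.IsOrbit (d • K) d κ x₀ F ∧
          x = (OuterLength.T (d • K))^[n] x₀ ∧ OuterLength.turn F n ≤ 10 := by
    intro d hd hd' x₀ hx₀ hn x hx
    obtain ⟨n, rfl, hN⟩ := hx
    obtain ⟨F, hF⟩ := (hbody d hd).exists_frames hx₀
    have ho : OuterLength.IsOrbit (d • K) d κ x₀ F :=
      ⟨hbody d hd, by rw [one_div_div] at hd'; exact hd'.le, hn, fun n => (hF n).1,
        fun n => (hF n).2⟩
    exact ⟨F, n, ho, rfl, by linarith [ho.turn_le hN, Real.pi_lt_d2]⟩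
  -- The choice of C₂ makes d < 1/C₂ the smallness condition of `IsOrbit`; ε = 1 lets 1 replace the
  -- summand d in C₃.
  refine ⟨1810 / κ ^ 2, 4000 / κ ^ 2, by positivity, by gcongr; norm_num, ?_, 1,
    1 + 24 / κ + (2 * (3606 / κ ^ 2) / κ + 128 / κ ^ 2), one_pos, by positivity, ?_⟩
  · intro d hd hd' x₀ hx₀ hn x hx
    obtain ⟨F, n, ho, rfl, hturn⟩ := horbit d hd hd' x₀ hx₀ hn x hx
    exact ho.norm_bound hturn
  · intro d hd hd' hd1 x₀ hx₀ hn r θ hr hx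
    obtain ⟨F, n, ho, hxn, hturn⟩ := horbit d hd hd' x₀ hx₀ hn _ hx
    obtain ⟨h1, h3⟩ := ho.energy_mem hturn
    have hs := ho.sees n
    obtain ⟨hout, hcl⟩ := hx₀ n
    rw [← hxn] at hs hout hcl
    have hsm := ho.small'
    refine (OuterLength.View.norm_chi_sub_le hs (hbody d hd) hout hcl (by linarith) h1 h3
      (ho.energy_bound n hturn) hr rfl).trans ?_
    linarith
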